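/- Let $\mathbb K$ be a field. For a topological space $X$ let $C^*(X;\mathbb K)$ be its singular cochain algebra (a differential graded algebra with the cup product), and for a DG algebra $A$ let $\mathrm D(A)$ be the derived category of right DG $A$-modules, i.e. the localization of the homotopy category of DG $A$-modules at the quasi-isomorphisms, with shift $(\Sigma M)^n=M^{n+1}$ and with exact triangles those isomorphic to the images of the cofibre sequences $M\xrightarrow{f}N\to C_f\to\Sigma M$. For an object $C$ of $\mathcal T=\mathrm D(A)$ put $\mathtt{thick}^0(C)=\{0\}$ (the zero objects), let $\mathtt{thick}^1(C)$ be the smallest strict full subcategory containing $C$ and closed under finite coproducts, retracts and all shifts, and for $n\ge 2$ let $\mathtt{thick}^n(C)$ be the smallest strict full subcategory closed under retracts and containing every $M$ that admits an exact triangle $M_1\to M\to M_2\to\Sigma M_1$ with $M_1\in\mathtt{thick}^{n-1}(C)$ and $M_2\in\mathtt{thick}^1(C)$. The $C$-level of $M$ is $\inf\{n\ge 0 : M\in\mathtt{thick}^n(C)\}\in\mathbb N\cup\{\infty\}$. For a continuous map $\alpha:Y\to X$, the level $\mathrm{level}_X(Y)$ of $Y$ over $X$ (of the map $\alpha$) is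 the $C^*(X;\mathbb K)$-level, in $\mathrm D(C^*(X;\mathbb K))$, of $C^*(Y;\mathbb K)$ regarded as a right DG $C^*(X;\mathbb K)$-module through $\alpha^*:C^*(X;\mathbb K)\to C^*(Y;\mathbb K)$. Let $\alpha:Y\to X$ and $\beta:Z\to X$ be continuous maps of topological spaces. If there exists a weak homotopy equivalence $f:Y\to Z$ (a continuous map inducing a bijection on path components and isomorphisms on $\pi_n$ for all $n\ge 1$ and all base points) such that $\alpha$ is homotopic to $\beta\circ f$, then $$\mathrm{level}_X(Z)=\mathrm{level}_X(Y).$$ -/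

import Mathlib

open CategoryTheory

universe u v w

namespace DGLevel

/-! ### Differential graded algebras -/

/-- A (cohomologically and `ℤ`-) graded differential algebra over the field `K`: the differential
raises the degree by one. The equations between degrees are passed as arguments, so that
the product of `a : X i` and `b : X j` is `mul h a b : X k` for every proof `h : i + j = k`. -/
structure DGAlgebra (K : Type v) [Field K] where
  X : ℤ → Type w
  [addCommGroup : ∀ i, AddCommGroup (X i)]
  [module : ∀ i, Module K (X i)]
  d {i j : ℤ} (h : i + 1 = j) : X i →ₗ[K] X j
  d_d {i j k : ℤ} (h : i + 1 = j) (h' : j + 1 = k) (a : X i) : d h' (d h a) = 0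
  one : X 0
  mul {i j k : ℤ} (h : i + j = k) : X i →ₗ[K] X j →ₗ[K] X k
  one_mul {i : ℤ} (a : X i) : mul (zero_add i) one a = a
  mul_one {i : ℤ} (a : X i) : mul (add_zero i) a one = a
  mul_assoc {i j k ij jk ijk : ℤ} (hij : i + j = ij) (hjk : j + k = jk) (h : ij + k = ijk)
    (h' : i + jk = ijk) (a : X i) (b : X j) (c : X k) :
    mul h (mul hij a b) c = mul h' a (mul hjk b c)
  leibniz {i j k i' j' k' : ℤ} (h : i + j = k) (hi : i + 1 = i') (hj : j + 1 = j')
    (hk : k + 1 = k') (h₁ : i' + j = k') (h₂ : i + j' = k') (a : X i) (b : X j) :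
    d hk (mul h a b) = mul h₁ (d hi a) b + i.negOnePow • mul h₂ a (d hj b)

attribute [instance] DGAlgebra.addCommGroup DGAlgebra.module

/-- Morphisms of DG algebras. -/
structure DGAlgebra.Hom {K : Type v} [Field K] (A B : DGAlgebra.{v, w} K) where
  f (i : ℤ) : A.X i →ₗ[K] B.X i
  map_d {i j : ℤ} (h : i + 1 = j) (a : A.X i) : f j (A.d h a) = B.d h (f i a)
  map_one : f 0 A.one = B.one
  map_mul {i j k : ℤ} (h : i + j = k) (a : A.X i) (b : A.X j) :
    f k (A.mul h a b) = B.mul h (f i a) (f j b)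

/-! ### The cochain algebra of a simplicial set -/

section Cochains

open Simplicial

variable (K : Type v) [Field K] (S : SSet.{u})

/-- The inclusion of the front `p`-face `[0, …, p]` of the `m`-simplex. -/
def frontFace {p m : ℕ} (h : p ≤ m) : ⦋p⦌ ⟶ ⦋m⦌ :=
  SimplexCategory.mkHom
    ⟨fun a : Fin (p + 1) => (⟨a, by omega⟩ : Fin (m + 1)), fun a b hab => by simpa using hab⟩

/-- The inclusion of the back `q`-face `[m - q, …, m]` of the `m`-simplex. -/
def backFace {q m : ℕ} (h : q ≤ m) : ⦋q⦌ ⟶ ⦋m⦌ :=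
  SimplexCategory.mkHom
    ⟨fun a : Fin (q + 1) => (⟨a + (m - q), by omega⟩ : Fin (m + 1)),
      fun a b hab => by simpa using hab⟩

/-- The `K`-valued cochains of degree `n : ℤ` on `S`: functions on the `n`-simplices of `S`
(the index type is empty if `n < 0`, and then this is the zero module). -/
abbrev Cochain (n : ℤ) : Type max u v := (m : {m : ℕ // (m : ℤ) = n}) → S _⦋m⦌ → K

namespace Cochain
variable {S}

/-- The coboundary `(dφ)(σ) = ∑ₜ (-1)ᵗ φ(∂ₜ σ)`. -/
def d {i j : ℤ} (h : i + 1 = j) : Cochain K S i →ₗ[K] Cochain K S j where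
  toFun φ
    | ⟨0, _⟩ => 0
    | ⟨m + 1, hm⟩ => fun σ => ∑ t : Fin (m + 2), (-1) ^ (t : ℕ) * φ ⟨m, by omega⟩ (S.δ t σ)
  map_add' φ ψ := by
    funext ⟨m, hm⟩
    cases m with
    | zero => simp
    | succ m => funext σ; simp [mul_add, Finset.sum_add_distrib]
  map_smul' c φ := by
    funext ⟨m, hm⟩
    cases m with
    | zero => simp
    | succ m => funext σ; simp [Finset.mul_sum, mul_left_comm]

/-- The cup product `(φ ∪ ψ)(σ) = φ(front face of σ) ψ(back face of σ)`. -/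
def mul {i j k : ℤ} (h : i + j = k) :
    Cochain K S i →ₗ[K] Cochain K S j →ₗ[K] Cochain K S k :=
  LinearMap.mk₂ K
    (fun φ ψ m σ => if hij : 0 ≤ i ∧ 0 ≤ j then
      φ ⟨i.toNat, by omega⟩
        (S.map (frontFace (p := i.toNat) (m := m) (by have := m.2; omega)).op σ) *
      ψ ⟨j.toNat, by omega⟩
        (S.map (backFace (q := j.toNat) (m := m) (by have := m.2; omega)).op σ) else 0)
    (by intros; funext m σ; dsimp; split_ifs <;> simp [add_mul])
    (by intros; funext m σ; dsimp; split_ifs <;> simp [mul_assoc])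
    (by intros; funext m σ; dsimp; split_ifs <;> simp [mul_add])
    (by intros; funext m σ; dsimp; split_ifs <;> simp [mul_left_comm])

/-- The unit cochain, constant with value one. -/
def one : Cochain K S 0 := fun _ _ => 1

lemma d_succ {i j : ℤ} (h : i + 1 = j) (φ : Cochain K S i) (m : ℕ) (hm : ((m + 1 : ℕ) : ℤ) = j)
    (σ : S _⦋m + 1⦌) :
    d K h φ ⟨m + 1, hm⟩ σ =
      ∑ t : Fin (m + 2), (-1) ^ (t : ℕ) * φ ⟨m, by omega⟩ (S.δ t σ) := rfl

lemma d_zero {i j : ℤ} (h : i + 1 = j) (φ : Cochain K S i) (hm : ((0 : ℕ) : ℤ) = j) :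
    d K h φ ⟨0, hm⟩ = 0 := rfl

lemma mul_nat {p q : ℕ} {k : ℤ} (h : (p : ℤ) + q = k) (φ : Cochain K S p) (ψ : Cochain K S q)
    (m : ℕ) (hm : (m : ℤ) = k) (σ : S _⦋m⦌) :
    mul K h φ ψ ⟨m, hm⟩ σ =
      φ ⟨p, rfl⟩ (S.map (frontFace (p := p) (m := m) (by omega)).op σ) *
      ψ ⟨q, rfl⟩ (S.map (backFace (q := q) (m := m) (by omega)).op σ) := by
  rw [mul, LinearMap.mk₂_apply]
  exact dif_pos (by omega)

lemma mul_neg {i j k : ℤ} (h : i + j = k) (φ : Cochain K S i) (ψ : Cochain K S j)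
    (hij : ¬ (0 ≤ i ∧ 0 ≤ j)) : mul K h φ ψ = 0 := by
  funext m σ
  exact dif_neg hij

lemma d_d_aux (m : ℕ) (F : Fin (m + 2) → Fin (m + 3) → K)
    (hF : ∀ a b : Fin (m + 2), a ≤ b → F a b.succ = F b a.castSucc) :
    ∑ b : Fin (m + 3), ∑ a : Fin (m + 2), (-1) ^ (b : ℕ) * ((-1) ^ (a : ℕ) * F a b) = 0 := by
  rw [Finset.sum_comm, ← Finset.sum_product']
  let P := Fin (m + 2) × Fin (m + 3)
  let T : Finset P := Finset.univ.filter fun ij => (ij.2 : ℕ) ≤ (ij.1 : ℕ)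
  rw [Finset.univ_product_univ, ← Finset.sum_add_sum_compl T, ← eq_neg_iff_add_eq_zero,
    ← Finset.sum_neg_distrib]
  refine Finset.sum_bij (fun ij hij =>
    ((Fin.castLT ij.2 (lt_of_le_of_lt (Finset.mem_filter.mp hij).right (Fin.is_lt ij.1)),
      ij.1.succ) : P)) ?_ ?_ ?_ ?_
  · intro ij hij
    simp only [T, Finset.compl_filter, Finset.mem_filter_univ, Fin.val_succ,
      Fin.val_castLT] at hij ⊢
    omega
  · rintro ⟨i, j⟩ hij ⟨i', j'⟩ hij' h
    have h1 := congrArg (fun x : P => (x.1 : ℕ)) h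
    have h2 := congrArg (fun x : P => (x.2 : ℕ)) h
    simp only [Fin.val_castLT, Fin.val_succ] at h1 h2
    ext
    · change (i : ℕ) = i'
      omega
    · exact h1
  · rintro ⟨i', j'⟩ hij'
    simp only [T, Finset.compl_filter, Finset.mem_filter_univ, not_le] at hij'
    refine ⟨(j'.pred ?_, Fin.castSucc i'), ?_, ?_⟩
    · rintro rfl
      simp at hij'
    · simp only [T, Finset.mem_filter_univ, Fin.val_castSucc, Fin.val_pred]
      omega
    · simp only [Fin.castLT_castSucc, Fin.succ_pred]
  · rintro ⟨i, j⟩ hij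
    have hij' : (j : ℕ) ≤ i := (Finset.mem_filter.mp hij).right
    have := hF (Fin.castLT j (lt_of_le_of_lt hij' i.is_lt)) i (by
      simpa [Fin.le_def] using hij')
    simp only [Fin.castSucc_castLT] at this
    simp only [this, Fin.val_castLT, Fin.val_succ]
    ring

lemma d_d {i j k : ℤ} (h : i + 1 = j) (h' : j + 1 = k) (φ : Cochain K S i) :
    d K h' (d K h φ) = 0 := by
  funext ⟨m, hm⟩ σ
  rcases m with _ | _ | m
  · rfl
  · simp [d_succ, d_zero]
  · simp only [d_succ, Pi.zero_apply, Finset.mul_sum]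
    exact d_d_aux K m (fun a b => φ ⟨m, by omega⟩ (S.δ a (S.δ b σ)))
      (fun a b hab => by
        have := ConcreteCategory.congr_hom (S.δ_comp_δ hab) σ
        simp only [ConcreteCategory.comp_apply] at this
        simp only [this])

lemma map_eq {p n : ℕ} {f g : ⦋p⦌ ⟶ ⦋n⦌}
    (h : ∀ a : Fin (p + 1),
      ((f.toOrderHom a : Fin (n + 1)) : ℕ) = (g.toOrderHom a : Fin (n + 1)))
    (σ : S _⦋n⦌) : S.map f.op σ = S.map g.op σ := by
  have : f = g := by
    ext a
    exact h a
  rw [this]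

lemma map_map {p n r : ℕ} (f : ⦋p⦌ ⟶ ⦋n⦌) (g : ⦋n⦌ ⟶ ⦋r⦌) (σ : S _⦋r⦌) :
    S.map f.op (S.map g.op σ) = S.map (f ≫ g).op σ := by
  simp

lemma δ_def {n : ℕ} (t : Fin (n + 2)) (σ : S _⦋n + 1⦌) :
    S.δ t σ = S.map (SimplexCategory.δ t).op σ := rfl

lemma δ_val {n : ℕ} (t : Fin (n + 2)) (a : Fin (n + 1)) :
    ((a : ℕ) < t ∧ (((SimplexCategory.δ t).toOrderHom a : Fin (n + 2)) : ℕ) = a) ∨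
      ((t : ℕ) ≤ a ∧ (((SimplexCategory.δ t).toOrderHom a : Fin (n + 2)) : ℕ) = a + 1) := by
  change ((a : ℕ) < t ∧ ((t.succAbove a : Fin (n + 2)) : ℕ) = a) ∨
      ((t : ℕ) ≤ a ∧ ((t.succAbove a : Fin (n + 2)) : ℕ) = a + 1)
  simp only [Fin.succAbove, Fin.lt_def, Fin.val_castSucc]
  split_ifs with h
  · exact Or.inl ⟨h, rfl⟩
  · exact Or.inr ⟨not_lt.1 h, rfl⟩

lemma comp_val {p n r : ℕ} (f : ⦋p⦌ ⟶ ⦋n⦌) (g : ⦋n⦌ ⟶ ⦋r⦌) (a : Fin (p + 1)) :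
    (((f ≫ g).toOrderHom a : Fin (r + 1)) : ℕ) = (g.toOrderHom (f.toOrderHom a) : Fin (r + 1)) :=
  rfl

lemma front_val {p m : ℕ} (h : p ≤ m) (a : Fin (p + 1)) :
    (((frontFace h).toOrderHom a : Fin (m + 1)) : ℕ) = a := rfl

lemma back_val {q m : ℕ} (h : q ≤ m) (a : Fin (q + 1)) :
    (((backFace h).toOrderHom a : Fin (m + 1)) : ℕ) = a + (m - q) := rfl

lemma leibniz_nat {p q : ℕ} (φ : S _⦋p⦌ → K) (ψ : S _⦋q⦌ → K) (σ : S _⦋p + q + 1⦌) :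
    ∑ t : Fin (p + q + 2), (-1) ^ (t : ℕ) *
        (φ (S.map (frontFace (show p ≤ p + q by omega)).op (S.δ t σ)) *
          ψ (S.map (backFace (show q ≤ p + q by omega)).op (S.δ t σ))) =
      (∑ t : Fin (p + 2), (-1) ^ (t : ℕ) *
        φ (S.δ t (S.map (frontFace (show p + 1 ≤ p + q + 1 by omega)).op σ))) *
          ψ (S.map (backFace (show q ≤ p + q + 1 by omega)).op σ) +
      (-1) ^ p * (φ (S.map (frontFace (show p ≤ p + q + 1 by omega)).op σ) *
        ∑ t : Fin (q + 2), (-1) ^ (t : ℕ) *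
          ψ (S.δ t (S.map (backFace (show q + 1 ≤ p + q + 1 by omega)).op σ))) := by
  have hpq : (p + 1) + (q + 1) = p + q + 2 := by omega
  rw [Fin.sum_univ_castSucc (n := p + 1), Fin.sum_univ_succ (n := q + 1),
    ← (finCongr hpq).sum_comp, Fin.sum_univ_add]
  simp only [δ_def, map_map]
  have t1 (x : Fin (p + 1)) : S.map (frontFace (show p ≤ p + q by omega) ≫
      SimplexCategory.δ (finCongr hpq (Fin.castAdd (q + 1) x))).op σ =
      S.map (SimplexCategory.δ x.castSucc ≫
        frontFace (show p + 1 ≤ p + q + 1 by omega)).op σ := by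
    refine map_eq (fun a => ?_) σ
    have h := δ_val (finCongr hpq (Fin.castAdd (q + 1) x))
      ((frontFace (show p ≤ p + q by omega)).toOrderHom a)
    have h' := δ_val x.castSucc a
    simp only [front_val, back_val, finCongr_apply, Fin.val_cast, Fin.val_castAdd,
      Fin.val_natAdd, Fin.val_castSucc, Fin.val_last, Fin.val_succ, Fin.val_zero, comp_val] at h h' ⊢
    omega
  have t2 (x : Fin (p + 1)) : S.map (backFace (show q ≤ p + q by omega) ≫
      SimplexCategory.δ (finCongr hpq (Fin.castAdd (q + 1) x))).op σ =
      S.map (backFace (show q ≤ p + q + 1 by omega)).op σ := by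
    refine map_eq (fun a => ?_) σ
    have h := δ_val (finCongr hpq (Fin.castAdd (q + 1) x))
      ((backFace (show q ≤ p + q by omega)).toOrderHom a)
    simp only [front_val, back_val, finCongr_apply, Fin.val_cast, Fin.val_castAdd,
      Fin.val_natAdd, Fin.val_castSucc, Fin.val_last, Fin.val_succ, Fin.val_zero, comp_val] at h ⊢
    omega
  have t3 (x : Fin (q + 1)) : S.map (frontFace (show p ≤ p + q by omega) ≫
      SimplexCategory.δ (finCongr hpq (Fin.natAdd (p + 1) x))).op σ =
      S.map (frontFace (show p ≤ p + q + 1 by omega)).op σ := by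
    refine map_eq (fun a => ?_) σ
    have h := δ_val (finCongr hpq (Fin.natAdd (p + 1) x))
      ((frontFace (show p ≤ p + q by omega)).toOrderHom a)
    simp only [front_val, back_val, finCongr_apply, Fin.val_cast, Fin.val_castAdd,
      Fin.val_natAdd, Fin.val_castSucc, Fin.val_last, Fin.val_succ, Fin.val_zero, comp_val] at h ⊢
    omega
  have t4 (x : Fin (q + 1)) : S.map (backFace (show q ≤ p + q by omega) ≫
      SimplexCategory.δ (finCongr hpq (Fin.natAdd (p + 1) x))).op σ =
      S.map (SimplexCategory.δ x.succ ≫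
        backFace (show q + 1 ≤ p + q + 1 by omega)).op σ := by
    refine map_eq (fun a => ?_) σ
    have h := δ_val (finCongr hpq (Fin.natAdd (p + 1) x))
      ((backFace (show q ≤ p + q by omega)).toOrderHom a)
    have h' := δ_val x.succ a
    simp only [front_val, back_val, finCongr_apply, Fin.val_cast, Fin.val_castAdd,
      Fin.val_natAdd, Fin.val_castSucc, Fin.val_last, Fin.val_succ, Fin.val_zero, comp_val] at h h' ⊢
    omega
  have t5 : S.map (SimplexCategory.δ (Fin.last (p + 1)) ≫
        frontFace (show p + 1 ≤ p + q + 1 by omega)).op σ =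
      S.map (frontFace (show p ≤ p + q + 1 by omega)).op σ := by
    refine map_eq (fun a => ?_) σ
    have h' := δ_val (Fin.last (p + 1)) a
    simp only [front_val, back_val, finCongr_apply, Fin.val_cast, Fin.val_castAdd,
      Fin.val_natAdd, Fin.val_castSucc, Fin.val_last, Fin.val_succ, Fin.val_zero, comp_val] at h' ⊢
    omega
  have t6 : S.map (SimplexCategory.δ 0 ≫
        backFace (show q + 1 ≤ p + q + 1 by omega)).op σ =
      S.map (backFace (show q ≤ p + q + 1 by omega)).op σ := by
    refine map_eq (fun a => ?_) σ
    have h' := δ_val 0 a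
    simp only [front_val, back_val, finCongr_apply, Fin.val_cast, Fin.val_castAdd,
      Fin.val_natAdd, Fin.val_castSucc, Fin.val_last, Fin.val_succ, Fin.val_zero, comp_val] at h' ⊢
    omega
  simp only [t1, t2, t3, t4, t5, t6]
  simp only [finCongr_apply, Fin.val_cast,
    Fin.val_castAdd, Fin.val_natAdd, Fin.val_castSucc, Fin.val_last, Fin.val_succ, Fin.val_zero]
  generalize S.map (frontFace _).op σ = u
  generalize S.map (backFace _).op σ = w
  simp only [mul_add, Finset.mul_sum, Finset.sum_mul, add_mul]
  have e1 : ∀ a b c e a' b' : K, a = a' → b = b' → c + e = 0 →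
      a + b = a' + c + (e + b') := by
    intro a b c e a' b' h h' h''
    rw [h, h']
    linear_combination -h''
  refine e1 _ _ _ _ _ _ (Finset.sum_congr rfl fun x _ => ?_)
    (Finset.sum_congr rfl fun x _ => ?_) ?_ <;> ring

lemma leibniz {i j k i' j' k' : ℤ} (h : i + j = k) (hi : i + 1 = i') (hj : j + 1 = j')
    (hk : k + 1 = k') (h₁ : i' + j = k') (h₂ : i + j' = k')
    (φ : Cochain K S i) (ψ : Cochain K S j) :
    d K hk (mul K h φ ψ) =
      mul K h₁ (d K hi φ) ψ + i.negOnePow • mul K h₂ φ (d K hj ψ) := by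
  rcases lt_or_ge i 0 with hi0 | hi0
  · rw [mul_neg K h _ _ (by omega), mul_neg K h₂ _ _ (by omega), map_zero, smul_zero, add_zero]
    by_cases hi' : i' = 0
    · have : d K hi φ = 0 := by
        funext ⟨m, hm⟩
        obtain rfl : m = 0 := by omega
        rfl
      rw [this, map_zero, LinearMap.zero_apply]
    · rw [mul_neg K h₁ _ _ (by omega)]
  rcases lt_or_ge j 0 with hj0 | hj0
  · rw [mul_neg K h _ _ (by omega), mul_neg K h₁ _ _ (by omega), map_zero, zero_add]
    by_cases hj' : j' = 0
    · have : d K hj ψ = 0 := by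
        funext ⟨m, hm⟩
        obtain rfl : m = 0 := by omega
        rfl
      rw [this, map_zero, smul_zero]
    · rw [mul_neg K h₂ _ _ (by omega), smul_zero]
  obtain ⟨p, rfl⟩ := Int.eq_ofNat_of_zero_le hi0
  obtain ⟨q, rfl⟩ := Int.eq_ofNat_of_zero_le hj0
  obtain rfl : i' = ((p + 1 : ℕ) : ℤ) := by omega
  obtain rfl : j' = ((q + 1 : ℕ) : ℤ) := by omega
  funext ⟨m, hm⟩ σ
  obtain rfl : m = p + q + 1 := by omega
  have hsign : ((p : ℤ).negOnePow • mul K h₂ φ (d K hj ψ)) ⟨p + q + 1, hm⟩ σ =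
      (-1) ^ p * mul K h₂ φ (d K hj ψ) ⟨p + q + 1, hm⟩ σ := by
    rw [Units.smul_def]
    simp [Int.negOnePow_def]
  rw [Pi.add_apply, Pi.add_apply, hsign, d_succ, mul_nat, mul_nat]
  simp only [d_succ, mul_nat]
  exact leibniz_nat K (φ ⟨p, rfl⟩) (ψ ⟨q, rfl⟩) σ

lemma one_mul {i : ℤ} (φ : Cochain K S i) : mul K (zero_add i) (one K) φ = φ := by
  funext ⟨m, hm⟩ σ
  obtain rfl := hm
  have : S.map (backFace (le_refl m)).op σ = S.map (𝟙 _) σ :=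
    map_eq (g := 𝟙 _) (fun a => by simp [back_val]) σ
  refine (mul_nat K (p := 0) (by simp) _ _ m rfl σ).trans ?_
  rw [this]
  simp [one]

lemma mul_one {i : ℤ} (φ : Cochain K S i) : mul K (add_zero i) φ (one K) = φ := by
  funext ⟨m, hm⟩ σ
  obtain rfl := hm
  have : S.map (frontFace (le_refl m)).op σ = S.map (𝟙 _) σ :=
    map_eq (g := 𝟙 _) (fun a => by simp [front_val]) σ
  refine (mul_nat K (q := 0) (by simp) _ _ m rfl σ).trans ?_
  rw [this]
  simp [one]

lemma mul_assoc {i j k ij jk ijk : ℤ} (hij : i + j = ij) (hjk : j + k = jk) (h : ij + k = ijk)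
    (h' : i + jk = ijk) (a : Cochain K S i) (b : Cochain K S j) (c : Cochain K S k) :
    mul K h (mul K hij a b) c = mul K h' a (mul K hjk b c) := by
  by_cases hi : 0 ≤ i
  swap
  · rw [mul_neg K hij a b (by omega), mul_neg K h' _ _ (by omega), map_zero, LinearMap.zero_apply]
  by_cases hj : 0 ≤ j
  swap
  · rw [mul_neg K hij a b (by omega), mul_neg K hjk _ _ (by omega), map_zero, map_zero,
      LinearMap.zero_apply]
  by_cases hk : 0 ≤ k
  swap
  · rw [mul_neg K h _ c (by omega), mul_neg K hjk _ _ (by omega), map_zero]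
  obtain ⟨p, rfl⟩ := Int.eq_ofNat_of_zero_le hi
  obtain ⟨q, rfl⟩ := Int.eq_ofNat_of_zero_le hj
  obtain ⟨r, rfl⟩ := Int.eq_ofNat_of_zero_le hk
  obtain rfl : ij = ((p + q : ℕ) : ℤ) := by omega
  obtain rfl : jk = ((q + r : ℕ) : ℤ) := by omega
  funext ⟨m, hm⟩ σ
  rw [mul_nat, mul_nat, mul_nat, mul_nat, map_map, map_map, map_map, map_map, _root_.mul_assoc]
  refine congrArg₂ (· * ·) (congrArg _ (map_eq (fun a => ?_) σ))
    (congrArg₂ (· * ·) (congrArg _ (map_eq (fun a => ?_) σ)) (congrArg _ (map_eq (fun a => ?_) σ)))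
  · simp only [comp_val, front_val]
  · simp only [comp_val, front_val, back_val]
    omega
  · simp only [comp_val, back_val]
    omega

/-- Pullback of cochains along a map of simplicial sets. -/
def map {S T : SSet.{u}} (f : S ⟶ T) (n : ℤ) : Cochain K T n →ₗ[K] Cochain K S n where
  toFun φ m σ := φ m (f.app _ σ)
  map_add' _ _ := rfl
  map_smul' _ _ := rfl

variable {T : SSet.{u}} (f : S ⟶ T)

lemma map_d {i j : ℤ} (h : i + 1 = j) (φ : Cochain K T i) :
    map K f j (d K h φ) = d K h (map K f i φ) := by
  funext ⟨m, hm⟩ σ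
  rcases m with _ | m
  · rfl
  · change d K h φ ⟨m + 1, hm⟩ (f.app _ σ) = _
    simp only [d_succ]
    refine Finset.sum_congr rfl fun t _ => ?_
    exact congrArg (fun x => (-1) ^ (t : ℕ) * φ ⟨m, by omega⟩ x)
      (ConcreteCategory.congr_hom (f.naturality (SimplexCategory.δ t).op) σ).symm

lemma map_mul {i j k : ℤ} (h : i + j = k) (φ : Cochain K T i) (ψ : Cochain K T j) :
    map K f k (mul K h φ ψ) = mul K h (map K f i φ) (map K f j ψ) := by
  by_cases hij : 0 ≤ i ∧ 0 ≤ j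
  swap
  · rw [mul_neg K h _ _ hij, mul_neg K h _ _ hij, map_zero]
  obtain ⟨p, rfl⟩ := Int.eq_ofNat_of_zero_le hij.1
  obtain ⟨q, rfl⟩ := Int.eq_ofNat_of_zero_le hij.2
  funext ⟨m, hm⟩ σ
  have hp : p ≤ m := by omega
  have hq : q ≤ m := by omega
  change mul K h φ ψ ⟨m, hm⟩ (f.app _ σ) = _
  rw [mul_nat, mul_nat]
  exact congrArg₂ (· * ·)
    (congrArg (φ ⟨p, rfl⟩)
      (ConcreteCategory.congr_hom (f.naturality (frontFace hp).op) σ).symm)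
    (congrArg (ψ ⟨q, rfl⟩)
      (ConcreteCategory.congr_hom (f.naturality (backFace hq).op) σ).symm)

lemma map_one : map K f 0 (one K) = one K := rfl

end Cochain

/-- The DG algebra of `K`-valued cochains on a simplicial set, with the cup product. -/
def cochainAlgebra : DGAlgebra.{v, max u v} K where
  X n := Cochain K S n
  d h := Cochain.d K h
  d_d h h' a := Cochain.d_d K h h' a
  one := Cochain.one K
  mul h := Cochain.mul K h
  one_mul a := Cochain.one_mul K a
  mul_one a := Cochain.mul_one K a
  mul_assoc hij hjk h h' a b c := Cochain.mul_assoc K hij hjk h h' a b c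
  leibniz h hi hj hk h₁ h₂ a b := Cochain.leibniz K h hi hj hk h₁ h₂ a b

/-- The morphism of cochain algebras induced by a map of simplicial sets. -/
def cochainMap {S T : SSet.{u}} (f : S ⟶ T) : (cochainAlgebra K T).Hom (cochainAlgebra K S) where
  f := Cochain.map K f
  map_d h a := Cochain.map_d K f h a
  map_one := rfl
  map_mul h a b := Cochain.map_mul K f h a b

end Cochains

/-! ### Differential graded modules -/

section Modules

variable {K : Type v} [Field K]

/-- Right DG modules over a DG algebra. -/
structure DGModule (A : DGAlgebra.{v, w} K) where
  X : ℤ → Type w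
  [addCommGroup : ∀ i, AddCommGroup (X i)]
  [module : ∀ i, Module K (X i)]
  d {i j : ℤ} (h : i + 1 = j) : X i →ₗ[K] X j
  d_d {i j k : ℤ} (h : i + 1 = j) (h' : j + 1 = k) (m : X i) : d h' (d h m) = 0
  act {i j k : ℤ} (h : i + j = k) : X i →ₗ[K] A.X j →ₗ[K] X k
  act_one {i : ℤ} (m : X i) : act (add_zero i) m A.one = m
  act_mul {i j k ij jk ijk : ℤ} (hij : i + j = ij) (hjk : j + k = jk) (h : ij + k = ijk)
    (h' : i + jk = ijk) (m : X i) (a : A.X j) (b : A.X k) :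
    act h (act hij m a) b = act h' m (A.mul hjk a b)
  leibniz {i j k i' j' k' : ℤ} (h : i + j = k) (hi : i + 1 = i') (hj : j + 1 = j')
    (hk : k + 1 = k') (h₁ : i' + j = k') (h₂ : i + j' = k') (m : X i) (a : A.X j) :
    d hk (act h m a) = act h₁ (d hi m) a + i.negOnePow • act h₂ m (A.d hj a)

attribute [instance] DGModule.addCommGroup DGModule.module

/-- For a morphism `φ : A → B` of DG algebras, `B` as a right DG `A`-module via `φ`. -/
def DGAlgebra.Hom.restrict {A B : DGAlgebra.{v, w} K} (φ : A.Hom B) : DGModule A where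
  X := B.X
  d h := B.d h
  d_d h h' := B.d_d h h'
  act {_ j _} h := (B.mul h).compl₂ (φ.f j)
  act_one m := by simp [φ.map_one, B.mul_one]
  act_mul hij hjk h h' m a b := by simp [φ.map_mul, B.mul_assoc hij hjk h h']
  leibniz h hi hj hk h₁ h₂ m a := by simp [φ.map_d, B.leibniz h hi hj hk h₁ h₂]

/-- `A` as a right DG module over itself. -/
def DGAlgebra.regular (A : DGAlgebra.{v, w} K) : DGModule A where
  X := A.X
  d h := A.d h
  d_d h h' := A.d_d h h'
  act h := A.mul h
  act_one := A.mul_one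
  act_mul := A.mul_assoc
  leibniz := A.leibniz

namespace DGModule
variable {A : DGAlgebra.{v, w} K}

/-- Morphisms of DG modules: `A`-linear chain maps of degree zero. -/
@[ext]
structure Hom (M N : DGModule A) where
  f (i : ℤ) : M.X i →ₗ[K] N.X i
  map_d {i j : ℤ} (h : i + 1 = j) (m : M.X i) : f j (M.d h m) = N.d h (f i m)
  map_act {i j k : ℤ} (h : i + j = k) (m : M.X i) (a : A.X j) :
    f k (M.act h m a) = N.act h (f i m) a

instance : Category (DGModule A) where
  Hom := Hom
  id M := { f := fun _ => LinearMap.id, map_d := fun _ _ => rfl, map_act := fun _ _ _ => rfl }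
  comp f g :=
    { f := fun i => (g.f i).comp (f.f i)
      map_d := fun h m => by simp [f.map_d, g.map_d]
      map_act := fun h m a => by simp [f.map_act, g.map_act] }

@[ext]
lemma hom_ext {M N : DGModule A} {f g : M ⟶ N} (h : ∀ i m, f.f i m = g.f i m) : f = g :=
  Hom.ext (funext fun i => LinearMap.ext (h i))

@[simp] lemma id_f (M : DGModule A) (i : ℤ) (m : M.X i) : Hom.f (𝟙 M) i m = m := rfl
@[simp] lemma comp_f {M N P : DGModule A} (f : M ⟶ N) (g : N ⟶ P) (i : ℤ) (m : M.X i) :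
    Hom.f (f ≫ g) i m = g.f i (f.f i m) := rfl

/-- Two morphisms are homotopic if `f - g = d s + s d` for an `A`-linear map `s` of degree `-1`. -/
def Homotopic {M N : DGModule A} (f g : M ⟶ N) : Prop :=
  ∃ s : ∀ {i j : ℤ}, j + 1 = i → (M.X i →ₗ[K] N.X j),
    (∀ {i j k i' k' : ℤ} (h : i + j = k) (hi : i' + 1 = i) (hk : k' + 1 = k) (h' : i' + j = k')
      (m : M.X i) (a : A.X j), s hk (M.act h m a) = N.act h' (s hi m) a) ∧
    ∀ {i j k : ℤ} (hij : j + 1 = i) (hik : i + 1 = k) (m : M.X i),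
      f.f i m - g.f i m = N.d hij (s hij m) + s hik (M.d hik m)

/-- The cocycles of degree `i`. -/
def cocycles (M : DGModule A) (i : ℤ) : Submodule K (M.X i) :=
  LinearMap.ker (M.d (rfl : i + 1 = i + 1))

/-- The coboundaries of degree `i`. -/
def coboundaries (M : DGModule A) (i : ℤ) : Submodule K (M.X i) :=
  LinearMap.range (M.d (sub_add_cancel i 1))

/-- The cohomology of degree `i`. -/
abbrev cohomology (M : DGModule A) (i : ℤ) : Type w :=
  M.cocycles i ⧸ (M.coboundaries i).submoduleOf (M.cocycles i)

/-- The map induced on cocycles. -/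
def cocyclesMap {M N : DGModule A} (f : M ⟶ N) (i : ℤ) : M.cocycles i →ₗ[K] N.cocycles i :=
  (f.f i).restrict fun m hm => by
    rw [cocycles, LinearMap.mem_ker] at hm ⊢
    rw [← f.map_d, hm, map_zero]

/-- The map induced on cohomology. -/
def cohomologyMap {M N : DGModule A} (f : M ⟶ N) (i : ℤ) : M.cohomology i →ₗ[K] N.cohomology i :=
  Submodule.mapQ _ _ (cocyclesMap f i) fun m hm => by
    obtain ⟨y, hy⟩ := hm
    exact ⟨f.f _ y, (f.map_d _ y).symm.trans (congrArg (f.f i) hy)⟩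

variable (A) in
/-- Quasi-isomorphisms: the morphisms that induce isomorphisms on cohomology. -/
def quasiIso : MorphismProperty (DGModule A) := fun _ _ f =>
  ∀ i, Function.Bijective (cohomologyMap f i)

/-- The shift `(Σⁿ M)ⁱ = Mⁱ⁺ⁿ`, with differential `(-1)ⁿ d` and the same right action. -/
def shift (M : DGModule A) (n : ℤ) : DGModule A where
  X i := M.X (i + n)
  d h := n.negOnePow • M.d (by omega)
  d_d h h' m := by
    simp [M.d_d]
  act h := M.act (by omega)
  act_one m := M.act_one m
  act_mul hij hjk h h' := M.act_mul _ _ _ _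
  leibniz {i j k i' j' k'} h hi hj hk h₁ h₂ m a := by
    simp only [LinearMap.smul_apply]
    rw [M.leibniz (i' := i' + n) (j' := j') (k' := k' + n) _ (by omega) hj _ (by omega) (by omega),
      smul_add, smul_smul, ← Int.negOnePow_add, show n + (i + n) = i + (n + n) by ring,
      Int.negOnePow_add i, Int.negOnePow_even (n + n) ⟨n, rfl⟩, _root_.mul_one]
    simp only [Units.smul_def, map_zsmul, LinearMap.smul_apply]

lemma shift_d (M : DGModule A) (n : ℤ) {i j : ℤ} (h : i + 1 = j) (h' : i + n + 1 = j + n)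
    (m : M.X (i + n)) : (M.shift n).d h m = (n.negOnePow : ℤ) • M.d h' m := rfl

/-- The shift of a morphism. -/
def shiftMap {M N : DGModule A} (f : M ⟶ N) (n : ℤ) : M.shift n ⟶ N.shift n where
  f i := f.f (i + n)
  map_d {i j} h m := by
    have h' : i + n + 1 = j + n := by omega
    change f.f (j + n) ((n.negOnePow : ℤ) • M.d h' (show M.X (i + n) from m)) =
      (n.negOnePow : ℤ) • N.d h' (f.f (i + n) m)
    rw [map_zsmul, f.map_d]
  map_act h m a := f.map_act _ m a

variable (A) in
/-- The shift functor. -/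
def shiftFunctor (n : ℤ) : DGModule A ⥤ DGModule A where
  obj M := M.shift n
  map f := shiftMap f n

/-- Transport along an equality of degrees. -/
def castX (M : DGModule A) {i j : ℤ} (h : i = j) : M.X i →ₗ[K] M.X j := h ▸ LinearMap.id

@[simp] lemma castX_rfl (M : DGModule A) {i : ℤ} (h : i = i) (m : M.X i) : M.castX h m = m := rfl

@[simp] lemma castX_castX (M : DGModule A) {i j k : ℤ} (h : i = j) (h' : j = k) (m : M.X i) :
    M.castX h' (M.castX h m) = M.castX (h.trans h') m := by
  subst h h'
  rfl

lemma castX_d (M : DGModule A) {i j i' j' : ℤ} (h : i + 1 = j) (hi : i = i') (hj : j = j')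
    (m : M.X i) : M.castX hj (M.d h m) = M.d (by omega) (M.castX hi m) := by
  subst hi hj
  rfl

lemma castX_act (M : DGModule A) {i j k i' k' : ℤ} (h : i + j = k) (hi : i = i') (hk : k = k')
    (m : M.X i) (a : A.X j) :
    M.castX hk (M.act h m a) = M.act (by omega) (M.castX hi m) a := by
  subst hi hk
  rfl

lemma map_castX {M N : DGModule A} (f : M ⟶ N) {i j : ℤ} (h : i = j) (m : M.X i) :
    f.f j (M.castX h m) = N.castX h (f.f i m) := by
  subst h
  rfl

lemma shift_castX (M : DGModule A) (n : ℤ) {i j : ℤ} (h : i = j) (m : (M.shift n).X i) :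
    (M.shift n).castX h m = M.castX (congrArg (· + n) h) m := by
  subst h
  rfl

/-- `Σ⁰ M ≅ M`. -/
def shiftZero (M : DGModule A) : M.shift 0 ≅ M where
  hom :=
    { f := fun i => M.castX (add_zero i)
      map_d := fun h m => by
        simp only [shift, Int.negOnePow_zero, one_smul]
        exact M.castX_d _ _ _ m
      map_act := fun h m a => M.castX_act _ _ _ m a }
  inv :=
    { f := fun i => M.castX (add_zero i).symm
      map_d := fun h m => by
        simp only [shift, Int.negOnePow_zero, one_smul]
        exact M.castX_d _ _ _ m
      map_act := fun h m a => M.castX_act _ _ _ m a }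
  hom_inv_id := hom_ext fun i m => M.castX_castX _ _ m
  inv_hom_id := hom_ext fun i m => M.castX_castX _ _ m

lemma negOnePow_add_int (a b : ℤ) :
    ((a + b).negOnePow : ℤ) = b.negOnePow * a.negOnePow := by
  rw [add_comm, Int.negOnePow_add, Units.val_mul]

/-- `Σᵃ⁺ᵇ M ≅ Σᵇ Σᵃ M`. -/
def shiftAdd (M : DGModule A) (a b : ℤ) : M.shift (a + b) ≅ (M.shift a).shift b where
  hom :=
    { f := fun i => M.castX (show i + (a + b) = i + b + a by omega)
      map_d := fun {i j} h (m : M.X (i + (a + b))) => by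
        have h₁ : i + (a + b) + 1 = j + (a + b) := by omega
        have h₂ : i + b + a + 1 = j + b + a := by omega
        change M.castX (show j + (a + b) = j + b + a by omega)
          (((a + b).negOnePow : ℤ) • M.d h₁ m) = (b.negOnePow : ℤ) • ((a.negOnePow : ℤ) •
            M.d h₂ (M.castX (show i + (a + b) = i + b + a by omega) m))
        rw [map_zsmul, smul_smul, negOnePow_add_int, M.castX_d]
      map_act := fun h m a => M.castX_act _ _ _ m a }
  inv :=
    { f := fun i => M.castX (show i + b + a = i + (a + b) by omega)
      map_d := fun {i j} h (m : M.X (i + b + a)) => by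
        have h₁ : i + (a + b) + 1 = j + (a + b) := by omega
        have h₂ : i + b + a + 1 = j + b + a := by omega
        change M.castX (show j + b + a = j + (a + b) by omega)
          ((b.negOnePow : ℤ) • ((a.negOnePow : ℤ) • M.d h₂ m)) =
            ((a + b).negOnePow : ℤ) •
            M.d h₁ (M.castX (show i + b + a = i + (a + b) by omega) m)
        rw [map_zsmul, map_zsmul, smul_smul, negOnePow_add_int, M.castX_d]
      map_act := fun h m a => M.castX_act _ _ _ m a }
  hom_inv_id := hom_ext fun i m => M.castX_castX _ _ m
  inv_hom_id := hom_ext fun i m => M.castX_castX _ _ m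

lemma eqToHom_shift_f (M : DGModule A) {a b : ℤ} (h : a = b)
    (h' : (shiftFunctor A a).obj M = (shiftFunctor A b).obj M) (i : ℤ) (m : M.X (i + a)) :
    Hom.f (eqToHom h') i m = M.castX (congrArg (i + ·) h) m := by
  subst h
  rfl

instance : HasShift (DGModule A) ℤ := hasShiftMk _ _
  { F := shiftFunctor A
    zero := NatIso.ofComponents (fun M => M.shiftZero)
      (fun f => hom_ext fun i m => (map_castX f _ m).symm)
    add := fun a b => NatIso.ofComponents (fun M => M.shiftAdd a b)
      (fun f => hom_ext fun i m => (map_castX f _ m).symm)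
    assoc_hom_app := fun a b c M => hom_ext fun i (m : M.X (i + (a + b + c))) => by
      refine Eq.trans ?_ (congrArg (fun x => Hom.f ((M.shift a).shiftAdd b c).hom i
        (Hom.f (M.shiftAdd a (b + c)).hom i x)) (eqToHom_shift_f M (add_assoc a b c) _ i m).symm)
      refine (M.castX_castX _ _ m).trans ?_
      refine Eq.trans ?_ (shift_castX M a _ _).symm
      exact (((congrArg _ (M.castX_castX _ _ m))).trans (M.castX_castX _ _ m)).symm
    zero_add_hom_app := fun n M => hom_ext fun i (m : M.X (i + (0 + n))) => by
      refine Eq.trans ?_ (congrArg (fun x => Hom.f M.shiftZero.inv (i + n) x)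
        (eqToHom_shift_f M (zero_add n) _ i m).symm)
      exact (M.castX_castX _ _ m).symm
    add_zero_hom_app := fun n M => hom_ext fun i (m : M.X (i + (n + 0))) => by
      refine Eq.trans ?_ (congrArg (fun x => Hom.f (M.shift n).shiftZero.inv i x)
        (eqToHom_shift_f M (add_zero n) _ i m).symm)
      refine Eq.trans ?_ (shift_castX M n _ _).symm
      exact (M.castX_castX _ _ m).symm }

lemma shift_map_f {M N : DGModule A} (f : M ⟶ N) (n i : ℤ) (m : M.X (i + n)) :
    Hom.f (f⟦n⟧') i m = f.f (i + n) m := rfl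

/-- Elementwise form of bijectivity on the cohomology of degree `i`. -/
def IsoAt {M N : DGModule A} (f : M ⟶ N) (k i j : ℤ) (hk : k + 1 = i) (hj : i + 1 = j) : Prop :=
  (∀ z : M.X i, M.d hj z = 0 → (∃ y, N.d hk y = f.f i z) → ∃ x, M.d hk x = z) ∧
  ∀ w : N.X i, N.d hj w = 0 → ∃ z, M.d hj z = 0 ∧ ∃ y, N.d hk y = w - f.f i z

lemma bijective_iff {M N : DGModule A} (f : M ⟶ N) (i : ℤ) :
    Function.Bijective (cohomologyMap f i) ↔
      IsoAt f (i - 1) i (i + 1) (sub_add_cancel i 1) rfl := by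
  refine and_congr ?_ ?_
  · rw [injective_iff_map_eq_zero]
    constructor
    · rintro h z hz ⟨y, hy⟩
      have := h (Submodule.Quotient.mk ⟨z, hz⟩)
        ((Submodule.Quotient.mk_eq_zero _).2 ⟨y, hy⟩)
      exact (Submodule.Quotient.mk_eq_zero _).1 this
    · intro h z
      obtain ⟨⟨z, hz⟩, rfl⟩ := Submodule.Quotient.mk_surjective _ z
      intro h0
      exact (Submodule.Quotient.mk_eq_zero _).2
        (h z hz ((Submodule.Quotient.mk_eq_zero _).1 h0))
  · constructor
    · intro h w hw
      obtain ⟨z, hz⟩ := h (Submodule.Quotient.mk ⟨w, hw⟩)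
      obtain ⟨⟨z, hz'⟩, rfl⟩ := Submodule.Quotient.mk_surjective _ z
      exact ⟨z, hz', (Submodule.Quotient.eq _).1 hz.symm⟩
    · intro h w
      obtain ⟨⟨w, hw⟩, rfl⟩ := Submodule.Quotient.mk_surjective _ w
      obtain ⟨z, hz, hy⟩ := h w hw
      exact ⟨Submodule.Quotient.mk ⟨z, hz⟩, ((Submodule.Quotient.eq _).2 hy).symm⟩

lemma quasiIso_iff {M N : DGModule A} (f : M ⟶ N) :
    quasiIso A f ↔ ∀ {k i j : ℤ} (hk : k + 1 = i) (hj : i + 1 = j), IsoAt f k i j hk hj := by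
  constructor
  · intro h k i j hk hj
    obtain rfl : k = i - 1 := by omega
    subst hj
    exact (bijective_iff f i).1 (h i)
  · intro h i
    exact (bijective_iff f i).2 (h _ _)

lemma zsmul_eq_zero_iff (n : ℤ) {V : Type*} [AddCommGroup V] (v : V) :
    (n.negOnePow : ℤ) • v = 0 ↔ v = 0 := by
  rw [← Units.smul_def]
  exact smul_eq_zero_iff_eq _

lemma shift_isoAt {M N : DGModule A} (f : M ⟶ N) (n : ℤ) {k i j : ℤ} (hk : k + 1 = i)
    (hj : i + 1 = j) : IsoAt (f⟦n⟧') k i j hk hj ↔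
      IsoAt f (k + n) (i + n) (j + n) (by omega) (by omega) := by
  have hk' : k + n + 1 = i + n := by omega
  have hj' : i + n + 1 = j + n := by omega
  have hz (P : DGModule A) (z : P.X (i + n)) :
      (P.shift n).d hj z = 0 ↔ P.d hj' z = 0 := by
    rw [P.shift_d n hj hj']
    exact zsmul_eq_zero_iff n _
  have hb (P : DGModule A) (z : P.X (i + n)) :
      (∃ y, (P.shift n).d hk y = z) ↔ ∃ y, P.d hk' y = z := by
    constructor
    · rintro ⟨y, rfl⟩
      exact ⟨(n.negOnePow : ℤ) • (show P.X (k + n) from y), (map_zsmul _ _ _)⟩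
    · rintro ⟨y, rfl⟩
      refine ⟨((n.negOnePow : ℤ) • y : P.X (k + n)), ?_⟩
      rw [P.shift_d n hk hk', map_zsmul, smul_smul, ← Units.val_mul]
      simp only [Int.units_mul_self, Units.val_one, one_smul]
      rfl
  refine and_congr ?_ ?_
  · exact forall_congr' fun z => imp_congr (hz M z) (imp_congr (hb N (f.f (i + n) z)) (hb M z))
  · exact forall_congr' fun (w : N.X (i + n)) => imp_congr (hz N w)
      (exists_congr fun (z : M.X (i + n)) => and_congr (hz M z) (hb N (w - f.f (i + n) z)))

instance : (quasiIso A).IsCompatibleWithShift ℤ where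
  condition n := by
    ext M N f
    rw [MorphismProperty.inverseImage_iff, quasiIso_iff, quasiIso_iff]
    constructor
    · intro h k i j hk hj
      have := (shift_isoAt f n (k := k - n) (i := i - n) (j := j - n) (by omega) (by omega)).1
        (h _ _)
      have e : ∀ {k i j k' i' j' : ℤ} (hk : k + 1 = i) (hj : i + 1 = j) (hk' : k' + 1 = i')
        (hj' : i' + 1 = j'), k = k' → IsoAt f k i j hk hj → IsoAt f k' i' j' hk' hj' := by
        intro k i j k' i' j' hk hj hk' hj' e h
        subst hk hj hk' hj' e
        exact h
      exact e _ _ _ _ (by omega) this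
    · intro h k i j hk hj
      exact (shift_isoAt f n hk hj).2 (h _ _)

/-- The mapping cone `C_f`, with `C_fⁱ = Nⁱ ⊕ Mⁱ⁺¹` and `d (y, x) = (d y + f x, - d x)`. -/
def cone {M N : DGModule A} (f : M ⟶ N) : DGModule A where
  X i := N.X i × M.X (i + 1)
  d {i j} h := LinearMap.prod
    ((N.d h).comp (LinearMap.fst K _ _) +
      ((f.f j).comp (M.castX h)).comp (LinearMap.snd K _ _))
    (-(M.d (by omega)).comp (LinearMap.snd K _ _))
  d_d h h' m := by
    subst h
    subst h'
    simp [N.d_d, M.d_d, f.map_d]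
  act h := LinearMap.mk₂ K (fun m a => (N.act h m.1 a, M.act (by omega) m.2 a))
    (by intros; simp) (by intros; simp) (by intros; simp) (by intros; simp)
  act_one m := Prod.ext (N.act_one _) (M.act_one _)
  act_mul hij hjk h h' m a b := Prod.ext (N.act_mul _ _ _ _ _ _ _) (M.act_mul _ _ _ _ _ _ _)
  leibniz {i j k i' j' k'} h hi hj hk h₁ h₂ m a := by
    obtain ⟨y, x⟩ := m
    refine Prod.ext ?_ ?_
    · change N.d hk (N.act h y a) + f.f k' (M.castX hk (M.act _ x a)) =
        N.act h₁ (N.d hi y + f.f i' (M.castX hi x)) a + i.negOnePow • N.act h₂ y (A.d hj a)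
      rw [N.leibniz h hi hj hk h₁ h₂, M.castX_act _ hi hk, f.map_act, map_add, LinearMap.add_apply]
      abel
    · change -M.d _ (M.act _ x a) =
        M.act _ (-M.d _ x) a + i.negOnePow • M.act _ x (A.d hj a)
      rw [M.leibniz (by omega) (show i + 1 + 1 = i' + 1 by omega) hj (by omega) (by omega)
        (by omega), Int.negOnePow_succ, map_neg, LinearMap.neg_apply, neg_add, Units.neg_smul,
        neg_neg]

/-- The inclusion `N → C_f`. -/
def coneInr {M N : DGModule A} (f : M ⟶ N) : N ⟶ cone f where
  f _ := LinearMap.inl K _ _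
  map_d h m := Prod.ext
    (show N.d h m = N.d h m + f.f _ (M.castX h 0) by simp)
    (show 0 = -M.d _ 0 by simp)
  map_act h m a := Prod.ext rfl
    (show 0 = M.act _ 0 a by simp)

/-- The projection `C_f → Σ M`. -/
def coneProj {M N : DGModule A} (f : M ⟶ N) : cone f ⟶ M⟦(1 : ℤ)⟧ where
  f i := LinearMap.snd K (N.X i) (M.X (i + 1))
  map_d {i j} h m := by
    change -M.d _ m.2 = (Int.negOnePow 1 : ℤ) • M.d _ m.2
    simp
  map_act _ _ _ := rfl

/-- The cofibre sequence `M → N → C_f → Σ M`. -/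
def coneTriangle {M N : DGModule A} (f : M ⟶ N) : Pretriangulated.Triangle (DGModule A) :=
  Pretriangulated.Triangle.mk f (coneInr f) (coneProj f)

variable (A) in
/-- The homotopy relation on morphisms. -/
def homotopyRel : HomRel (DGModule A) := fun _ _ f g => Homotopic f g

lemma Homotopic.refl {M N : DGModule A} (f : M ⟶ N) : Homotopic f f :=
  ⟨fun _ => 0, by simp, by simp⟩

lemma Homotopic.symm {M N : DGModule A} {f g : M ⟶ N} : Homotopic f g → Homotopic g f := by
  rintro ⟨s, hs, h⟩
  refine ⟨fun hi => -s hi, fun h₁ h₂ h₃ h₄ m a => ?_, fun h₁ h₂ m => ?_⟩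
  · simp [hs h₁ h₂ h₃ h₄]
  · rw [← neg_sub, h h₁ h₂]
    simp [add_comm]

lemma Homotopic.trans {M N : DGModule A} {f g k : M ⟶ N} :
    Homotopic f g → Homotopic g k → Homotopic f k := by
  rintro ⟨s, hs, h⟩ ⟨s', hs', h'⟩
  refine ⟨fun hi => s hi + s' hi, fun h₁ h₂ h₃ h₄ m a => ?_, fun h₁ h₂ m => ?_⟩
  · simp [hs h₁ h₂ h₃ h₄, hs' h₁ h₂ h₃ h₄]
  · rw [← sub_add_sub_cancel _ (g.f _ m), h h₁ h₂, h' h₁ h₂]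
    simp only [LinearMap.add_apply, map_add]
    abel

instance : Congruence (homotopyRel A) where
  equivalence := ⟨Homotopic.refl, Homotopic.symm, Homotopic.trans⟩
  comp_left := by
    rintro M N P f g g' ⟨s, hs, h⟩
    refine ⟨fun hi => (s hi).comp (f.f _), fun h₁ h₂ h₃ h₄ m a => ?_, fun h₁ h₂ m => ?_⟩
    · simp [f.map_act h₁, hs h₁ h₂ h₃ h₄]
    · simp [h h₁ h₂, f.map_d]
  comp_right := by
    rintro M N P f f' g ⟨s, hs, h⟩
    refine ⟨fun hi => (g.f _).comp (s hi), fun h₁ h₂ h₃ h₄ m a => ?_, fun h₁ h₂ m => ?_⟩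
    · simp [g.map_act h₄, hs h₁ h₂ h₃ h₄]
    · rw [comp_f, comp_f, ← map_sub, h h₁ h₂]
      simp [g.map_d]

instance : (homotopyRel A).IsCompatibleWithShift ℤ where
  condition := by
    rintro n M N f g ⟨s, hs, h⟩
    refine ⟨fun {i j} hi => (n.negOnePow : ℤ) • s (show j + n + 1 = i + n by omega),
      fun {i j k i' k'} h₁ h₂ h₃ h₄ (m : M.X (i + n)) a => ?_,
      fun {i j k} h₁ h₂ (m : M.X (i + n)) => ?_⟩
    · change (n.negOnePow : ℤ) • s _ (M.act _ m a) = N.act _ ((n.negOnePow : ℤ) • s _ m) a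
      rw [hs (show i + n + j = k + n by omega) (show i' + n + 1 = i + n by omega)
        (show k' + n + 1 = k + n by omega) (show i' + n + j = k' + n by omega),
        map_zsmul, LinearMap.smul_apply]
    · change f.f (i + n) m - g.f (i + n) m =
        (n.negOnePow : ℤ) • N.d _ ((n.negOnePow : ℤ) • s _ m) +
          (n.negOnePow : ℤ) • s _ ((n.negOnePow : ℤ) • M.d _ m)
      rw [h (show j + n + 1 = i + n by omega) (show i + n + 1 = k + n by omega), map_zsmul,
        map_zsmul, smul_smul, smul_smul, ← Units.val_mul]
      simp only [Int.units_mul_self, Units.val_one, one_smul]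
      rfl

variable (A) in
/-- The homotopy category `H(A)` of DG `A`-modules. -/
abbrev HomotopyCategory := Quotient (homotopyRel A)

variable (A) in
/-- Cohomology of degree `i` as a functor. -/
def cohomologyFunctor (i : ℤ) : DGModule A ⥤ ModuleCat.{w} K where
  obj M := ModuleCat.of K (M.cohomology i)
  map f := ModuleCat.ofHom (cohomologyMap f i)
  map_id M := by
    ext m
    rfl
  map_comp f g := by
    ext m
    rfl

lemma cohomologyMap_eq_of_homotopic {M N : DGModule A} {f g : M ⟶ N} (h : Homotopic f g) (i : ℤ) :
    cohomologyMap f i = cohomologyMap g i := by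
  obtain ⟨s, -, h⟩ := h
  ext m
  obtain ⟨m, hm⟩ := m
  refine (Submodule.Quotient.eq _).2 ⟨s (sub_add_cancel i 1) m, ?_⟩
  have hm' : M.d (rfl : i + 1 = i + 1) m = 0 := hm
  have := h (sub_add_cancel i 1) rfl m
  rw [hm', map_zero, add_zero] at this
  exact this.symm

variable (A) in
/-- Cohomology of degree `i` on the homotopy category. -/
def homotopyCohomologyFunctor (i : ℤ) : HomotopyCategory A ⥤ ModuleCat.{w} K :=
  CategoryTheory.Quotient.lift _ (cohomologyFunctor A i) fun _ _ _ _ h =>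
    congrArg ModuleCat.ofHom (cohomologyMap_eq_of_homotopic h i)

variable (A) in
/-- Quasi-isomorphisms in the homotopy category. -/
def homotopyQuasiIso : MorphismProperty (HomotopyCategory A) := fun _ _ f =>
  ∀ i, IsIso ((homotopyCohomologyFunctor A i).map f)

instance : (homotopyQuasiIso A).RespectsIso :=
  MorphismProperty.RespectsIso.mk _
    (fun e f hf i => by
      have := hf i
      rw [Functor.map_comp]
      infer_instance)
    (fun e f hf i => by
      have := hf i
      rw [Functor.map_comp]
      infer_instance)

lemma homotopyQuasiIso_iff {M N : DGModule A} (f : M ⟶ N) :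
    homotopyQuasiIso A ((Quotient.functor (homotopyRel A)).map f) ↔ quasiIso A f :=
  forall_congr' fun i =>
    ConcreteCategory.isIso_iff_bijective (ModuleCat.ofHom (cohomologyMap f i))

instance : (homotopyQuasiIso A).IsCompatibleWithShift ℤ where
  condition n := by
    ext M N f
    obtain ⟨f, rfl⟩ := (Quotient.functor (homotopyRel A)).map_surjective f
    rw [MorphismProperty.inverseImage_iff, homotopyQuasiIso_iff,
      ← MorphismProperty.IsCompatibleWithShift.iff (quasiIso A) f n, ← homotopyQuasiIso_iff]
    exact ((homotopyQuasiIso A).arrow_mk_iso_iff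
      (Arrow.isoMk (((Quotient.functor (homotopyRel A)).commShiftIso n).app _)
        (((Quotient.functor (homotopyRel A)).commShiftIso n).app _)
        (((Quotient.functor (homotopyRel A)).commShiftIso n).hom.naturality f).symm)).symm

end DGModule

variable (A : DGAlgebra.{v, w} K)

/-- The derived category `D(A)`: the localization of the homotopy category of DG `A`-modules at
the quasi-isomorphisms. It carries the induced shift by `ℤ`. -/
abbrev DerivedCategory := (DGModule.homotopyQuasiIso A).Localization

namespace DerivedCategory

/-- The localization functor from DG `A`-modules to `D(A)`. -/
noncomputable def Q : DGModule A ⥤ DerivedCategory A :=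
  Quotient.functor (DGModule.homotopyRel A) ⋙ (DGModule.homotopyQuasiIso A).Q

noncomputable instance : (Q A).CommShift ℤ :=
  inferInstanceAs ((Quotient.functor (DGModule.homotopyRel A) ⋙
    (DGModule.homotopyQuasiIso A).Q).CommShift ℤ)

/-- The exact triangles of `D(A)`: those isomorphic in `D(A)` to the image of a cofibre sequence
`M → N → C_f → Σ M`. -/
def distinguishedTriangles : Set (Pretriangulated.Triangle (DerivedCategory A)) :=
  {T | ∃ (M N : DGModule A) (f : M ⟶ N),
    Nonempty (T ≅ (Q A).mapTriangle.obj (DGModule.coneTriangle f))}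

end DerivedCategory

end Modules

/-! ### Thickenings and levels -/

section Level

variable {T : Type*} [Category T] [HasShift T ℤ]

/-- The first thickening of `C`: the smallest strict full subcategory that contains `C` and is
closed under finite coproducts, retracts and all shifts. -/
def thick₁ (C : T) : ObjectProperty T := fun M =>
  ∀ P : ObjectProperty T, P.IsClosedUnderIsomorphisms → P.IsClosedUnderFiniteCoproducts →
    P.IsStableUnderRetracts → P.IsStableUnderShift ℤ → P C → P M

/-- The `n`th thickening of `C`, where `Δ` is the class of exact triangles of `T`. For `n ≥ 2` it is
the smallest strict full subcategory that is closed under retracts and contains every `M` that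
admits an exact triangle `M₁ → M → M₂ → Σ M₁` with `M₁` in the `(n - 1)`st and `M₂` in the first
thickening. -/
def thick (Δ : Set (Pretriangulated.Triangle T)) (C : T) : ℕ → ObjectProperty T
  | 0 => fun M => Limits.IsZero M
  | 1 => thick₁ C
  | n + 2 => fun M => ∀ P : ObjectProperty T, P.IsClosedUnderIsomorphisms →
      P.IsStableUnderRetracts →
      (∀ t ∈ Δ, thick Δ C (n + 1) t.obj₁ → thick₁ C t.obj₃ → P t.obj₂) → P M

/-- The `C`-level of `M`: the infimum of the `n` such that `M` lies in the `n`th thickening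
of `C`; it is `⊤` if there is no such `n`. -/
noncomputable def level (Δ : Set (Pretriangulated.Triangle T)) (C M : T) : ℕ∞ :=
  ⨅ (n : ℕ) (_ : thick Δ C n M), (n : ℕ∞)

end Level

/-! ### Weak homotopy equivalences -/

section Spaces

variable {X Y : Type u} [TopologicalSpace X] [TopologicalSpace Y]

/-- Composition of a generalized loop with a continuous map. -/
def genLoopMap (f : C(X, Y)) {N : Type*} {x : X} (γ : GenLoop N X x) : GenLoop N Y (f x) :=
  ⟨f.comp γ.1, fun t ht => congrArg f (γ.2 t ht)⟩

/-- The map `π_N(X, x) → π_N(Y, f x)` induced by `f`. -/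
def homotopyGroupMap (f : C(X, Y)) (N : Type*) (x : X) :
    HomotopyGroup N X x → HomotopyGroup N Y (f x) :=
  Quotient.map (genLoopMap f) fun _ _ h => h.comp_continuousMap f

/-- The map induced by `f` on sets of path components. -/
def zerothHomotopyMap (f : C(X, Y)) : ZerothHomotopy X → ZerothHomotopy Y :=
  Quotient.map f fun _ _ h => h.map f.continuous

/-- `f` is a weak homotopy equivalence: it induces a bijection on path components and, for all
`n ≥ 1` and all base points, a bijection on `π_n`. -/
def IsWeakHomotopyEquiv (f : C(X, Y)) : Prop :=
  Function.Bijective (zerothHomotopyMap f) ∧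
    ∀ (n : ℕ) (x : X), Function.Bijective (homotopyGroupMap f (Fin (n + 1)) x)

end Spaces

/-! ### The level of a map -/

section LevelOfMap

variable (K : Type v) [Field K]

/-- The singular cochain algebra `C^*(X; K)`. -/
noncomputable abbrev singularCochains (X : Type u) [TopologicalSpace X] :
    DGAlgebra.{v, max u v} K :=
  cochainAlgebra K (TopCat.toSSet.obj (TopCat.of X))

variable {X Y : Type u} [TopologicalSpace X] [TopologicalSpace Y]

/-- The morphism of DG algebras `α^* : C^*(X; K) → C^*(Y; K)` induced by `α : Y → X`. -/
noncomputable def singularCochainsMap (α : C(Y, X)) :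
    (singularCochains K X).Hom (singularCochains K Y) :=
  cochainMap K (TopCat.toSSet.map (TopCat.ofHom α))

/-- The level of a map `α : Y → X`: the `C^*(X; K)`-level of `C^*(Y; K)`, regarded as a DG
`C^*(X; K)`-module via `α^*`, in the derived category `D(C^*(X; K))`. -/
noncomputable def levelOver (α : C(Y, X)) : ℕ∞ :=
  level (DerivedCategory.distinguishedTriangles (singularCochains K X))
    ((DerivedCategory.Q _).obj (singularCochains K X).regular)
    ((DerivedCategory.Q _).obj (singularCochainsMap K α).restrict)

end LevelOfMap

end DGLevel

/-!
The point is that a weak homotopy equivalence `f : Y → Z` induces a bijection on singular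
cohomology. By the homotopy extension property of balls, lifting problems against `f` may be
deformed to ones with constant data on the sphere, which are solved by the hypotheses on homotopy
groups. So the mapping path fibration of `f` has the right lifting property against boundaries of
simplices and its singular simplicial map is a trivial fibration; such a map is a simplicial
homotopy equivalence, and cochains are homotopy invariant. The homotopy from `α` to `β ∘ f` is
handled in the same way: the two inclusions of `Y` in its cylinder are maps over `X` which are
bijective on cohomology.
-/

namespace DGLevel

/-! ### Lifting problems on balls -/

section Balls

open Set unitInterval

variable {E W : Type*} [NormedAddCommGroup E] [TopologicalSpace W]

/-- The unit sphere of `E`, cut out by the norm alone. -/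
abbrev unitSphere (E : Type*) [Norm E] : Set E := {x | ‖x‖ = 1}

lemma isClosed_unitSphere : IsClosed (unitSphere E) :=
  isClosed_eq continuous_norm continuous_const

lemma continuousOn_comp_one_sub {q : E × ℝ → W} (hq : ContinuousOn q (unitSphere E ×ˢ I)) :
    ContinuousOn (fun z : E × ℝ => q (z.1, 1 - z.2)) (unitSphere E ×ˢ I) :=
  hq.comp (by fun_prop) fun _ hz => ⟨hz.1, Icc.mem_iff_one_sub_mem.1 hz.2⟩

lemma norm_prod_eq_one {x : E} {r : ℝ} :
    ‖(x, r)‖ = 1 ↔ (‖x‖ ≤ 1 ∧ (r = -1 ∨ r = 1)) ∨ (‖x‖ = 1 ∧ -1 ≤ r ∧ r ≤ 1) := by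
  rw [Prod.norm_mk, Real.norm_eq_abs, max_eq_iff, ← abs_le]
  grind [abs_eq_max_neg]

/-- Bottom, top and side maps glue to a family of maps on the sphere of `E × ℝ`; its height
`r ∈ [-1, 1]` is rescaled to the parameter `(r + 1) / 2` of the side. -/
lemma exists_glue_prism {b u : E × ℝ → W} {m : (E × ℝ) × ℝ → W} (hb : Continuous b)
    (hu : Continuous u) (hm : ContinuousOn m ((unitSphere E ×ˢ I) ×ˢ I))
    (hbm : ∀ x, ‖x‖ = 1 → ∀ τ ∈ I, m ((x, 0), τ) = b (x, τ))
    (hum : ∀ x, ‖x‖ = 1 → ∀ τ ∈ I, m ((x, 1), τ) = u (x, τ)) :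
    ∃ q : (E × ℝ) × ℝ → W, ContinuousOn q (unitSphere (E × ℝ) ×ˢ I) ∧
      (∀ x τ, q ((x, -1), τ) = b (x, τ)) ∧ (∀ x τ, q ((x, 1), τ) = u (x, τ)) ∧
      ∀ x, ‖x‖ = 1 → ∀ t ∈ I, ∀ τ ∈ I, q ((x, 2 * t - 1), τ) = m ((x, t), τ) := by
  let q (z : (E × ℝ) × ℝ) : W := if z.1.2 = -1 then b (z.1.1, z.2) else
    if z.1.2 = 1 then u (z.1.1, z.2) else m ((z.1.1, (z.1.2 + 1) / 2), z.2)
  have q_bot (x τ) : q ((x, -1), τ) = b (x, τ) := if_pos rfl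
  have q_top (x τ) : q ((x, 1), τ) = u (x, τ) := by norm_num [q]
  have q_side (x : E) (hx : ‖x‖ = 1) (r) (τ) (hτ : τ ∈ I) :
      q ((x, r), τ) = m ((x, (r + 1) / 2), τ) := by
    simp only [q]
    split_ifs with h h
    · simp [h, hbm x hx τ hτ]
    · simp [h, hum x hx τ hτ]
    · rfl
  refine ⟨q, ?_, q_bot, q_top, fun x hx t _ τ hτ => by rw [q_side x hx _ τ hτ]; simp⟩
  have side_closed : IsClosed ((unitSphere E ×ˢ Icc (-1 : ℝ) 1) ×ˢ I) :=
    (isClosed_unitSphere.prod isClosed_Icc).prod isClosed_Icc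
  have bot_closed : IsClosed {z : (E × ℝ) × ℝ | z.1.2 = -1} :=
    isClosed_eq (by fun_prop) continuous_const
  have top_closed : IsClosed {z : (E × ℝ) × ℝ | z.1.2 = 1} :=
    isClosed_eq (by fun_prop) continuous_const
  refine ContinuousOn.mono (ContinuousOn.union_of_isClosed (ContinuousOn.union_of_isClosed
    (s := {z | z.1.2 = -1}) (t := {z | z.1.2 = 1}) ?_ ?_ bot_closed top_closed)
    (t := (unitSphere E ×ˢ Icc (-1 : ℝ) 1) ×ˢ I) ?_ (bot_closed.union top_closed) side_closed) ?_
  · refine ContinuousOn.congr (f := fun z => b (z.1.1, z.2)) (by fun_prop) ?_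
    rintro ⟨⟨x, r⟩, τ⟩ rfl
    exact q_bot x τ
  · refine ContinuousOn.congr (f := fun z => u (z.1.1, z.2)) (by fun_prop) ?_
    rintro ⟨⟨x, r⟩, τ⟩ rfl
    exact q_top x τ
  · refine ContinuousOn.congr (f := fun z => m ((z.1.1, (z.1.2 + 1) / 2), z.2))
      (hm.comp (by fun_prop) fun z hz => ⟨⟨hz.1.1, ?_, ?_⟩, hz.2⟩)
      fun z hz => q_side z.1.1 hz.1.1 z.1.2 z.2 hz.2
    · linarith [hz.1.2.1]
    · linarith [hz.1.2.2]
  · rintro ⟨⟨x, r⟩, τ⟩ ⟨hz, hτ⟩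
    exact (norm_prod_eq_one.1 hz).imp And.right fun h => ⟨h, hτ⟩

variable {Y Z : Type*} [TopologicalSpace Y] [TopologicalSpace Z]

/-- Solvability of the lifting problem against `f` given by `y` on the unit sphere, `s` on the unit
ball and a homotopy `h` from `f ∘ y` to `s` on the sphere: `y` extends to a map `g` on the ball, and
`h` to a homotopy `H` from `f ∘ g` to `s`. -/
def HasLift (f : Y → Z) (y : E → Y) (h : E × ℝ → Z) (s : E → Z) : Prop :=
  ∃ (g : E → Y) (H : E × ℝ → Z), Continuous g ∧ Continuous H ∧ (∀ x, ‖x‖ = 1 → g x = y x) ∧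
    (∀ x, ‖x‖ ≤ 1 → H (x, 0) = f (g x)) ∧ (∀ x, ‖x‖ ≤ 1 → H (x, 1) = s x) ∧
    ∀ x, ‖x‖ = 1 → ∀ t ∈ I, H (x, t) = h (x, t)

lemma HasLift.congr {f : Y → Z} {y y' : E → Y} {h h' : E × ℝ → Z} {s : E → Z}
    (H : HasLift f y h s) (hy : ∀ x, ‖x‖ = 1 → y x = y' x)
    (hh : ∀ x, ‖x‖ = 1 → ∀ t ∈ I, h (x, t) = h' (x, t)) : HasLift f y' h' s := by
  obtain ⟨g, G, hg, hG, hgy, hG₀, hG₁, hGh⟩ := H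
  exact ⟨g, G, hg, hG, fun x hx => (hgy x hx).trans (hy x hx), hG₀, hG₁,
    fun x hx t ht => (hGh x hx t ht).trans (hh x hx t ht)⟩

variable [NormedSpace ℝ E]

/-- The radial retraction of `E` onto its closed unit ball. -/
noncomputable def ballRetract (x : E) : E := (max ‖x‖ 1)⁻¹ • x

@[fun_prop]
lemma continuous_ballRetract : Continuous (ballRetract : E → E) := by
  refine Continuous.smul (Continuous.inv₀ (by fun_prop) fun x => ?_) continuous_id
  positivity

lemma ballRetract_of_le {x : E} (hx : ‖x‖ ≤ 1) : ballRetract x = x := by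
  simp [ballRetract, max_eq_right hx]

lemma norm_ballRetract (x : E) : ‖ballRetract x‖ = min ‖x‖ 1 := by
  rw [ballRetract, norm_smul, norm_inv, Real.norm_eq_abs, abs_of_pos (by positivity)]
  rcases le_total ‖x‖ 1 with h | h
  · rw [max_eq_right h, min_eq_left h, inv_one, one_mul]
  · rw [max_eq_left h, min_eq_right h, inv_mul_cancel₀ (by positivity)]

lemma norm_ballRetract_le (x : E) : ‖ballRetract x‖ ≤ 1 :=
  (norm_ballRetract x).le.trans (min_le_right _ _)

lemma exists_collar {a : E → W} {q : E × ℝ → W} (ha : Continuous a)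
    (hq : ContinuousOn q (unitSphere E ×ˢ I)) (h : ∀ x, ‖x‖ = 1 → q (x, 0) = a x) :
    ∃ c : E → W, Continuous c ∧ (∀ x, ‖x‖ ≤ 1 → c x = a x) ∧
      ∀ x, ‖x‖ = 1 → ∀ t ∈ I, c ((1 + t) • x) = q (x, t) := by
  let c (x : E) : W := if ‖x‖ ≤ 1 then a x else q (‖x‖⁻¹ • x, min (‖x‖ - 1) 1)
  have c_of_le {x : E} (hx : ‖x‖ ≤ 1) : c x = a x := if_pos hx
  refine ⟨c, ?_, fun x => c_of_le, fun x hx t ht => ?_⟩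
  · have ne_zero {x : E} (hx : 1 ≤ ‖x‖) : ‖x‖ ≠ 0 := by positivity
    refine continuous_if_le continuous_norm continuous_const ha.continuousOn
      (hq.comp (ContinuousOn.prodMk (ContinuousOn.smul (ContinuousOn.inv₀ (by fun_prop)
        fun x hx => ne_zero hx) (by fun_prop)) (by fun_prop)) fun x (hx : 1 ≤ ‖x‖) => ?_)
      fun x hx => ?_
    · exact ⟨by simp [norm_smul, ne_zero hx], le_min (by linarith) zero_le_one, min_le_right _ _⟩
    · simp [hx, h]
  · have hn : ‖(1 + t) • x‖ = 1 + t := by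
      rw [norm_smul, hx, Real.norm_eq_abs, abs_of_nonneg (by linarith [ht.1]), mul_one]
    rcases ht.1.eq_or_lt with rfl | h0
    · rw [c_of_le (by simp [hx]), h x hx, add_zero, one_smul]
    · simp only [c]
      rw [if_neg (by linarith), hn, smul_smul, inv_mul_cancel₀ (by linarith), one_smul,
        add_sub_cancel_left, min_eq_left ht.2]

lemma exists_homotopy_extension {a : E → W} {q : E × ℝ → W} (ha : Continuous a)
    (hq : ContinuousOn q (unitSphere E ×ˢ I)) (h : ∀ x, ‖x‖ = 1 → q (x, 0) = a x) :
    ∃ Q : E × ℝ → W, Continuous Q ∧ (∀ x, ‖x‖ ≤ 1 → Q (x, 0) = a x) ∧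
      ∀ x, ‖x‖ = 1 → ∀ t ∈ I, Q (x, t) = q (x, t) := by
  obtain ⟨c, hc, hca, hcq⟩ := exists_collar ha hq h
  exact ⟨fun z => c ((1 + z.2) • z.1), by fun_prop, fun x hx => by simp [hca x hx], hcq⟩

lemma exists_extension_of_homotopy {q : E × ℝ → W} (hq : ContinuousOn q (unitSphere E ×ˢ I))
    (h : ∃ g : E → W, Continuous g ∧ ∀ x, ‖x‖ = 1 → g x = q (x, 1)) :
    ∃ g : E → W, Continuous g ∧ ∀ x, ‖x‖ = 1 → g x = q (x, 0) := by
  obtain ⟨g, hg, hgq⟩ := h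
  obtain ⟨Q, hQ, -, hQq⟩ := exists_homotopy_extension hg (continuousOn_comp_one_sub hq)
    fun x hx => by simp [hgq x hx]
  exact ⟨fun x => Q (x, 1), by fun_prop, fun x hx => by simp [hQq x hx 1 (by simp)]⟩

lemma exists_prism_extension_of_homotopy {b u : E × ℝ → W} {m : (E × ℝ) × ℝ → W}
    (hb : Continuous b) (hu : Continuous u) (hm : ContinuousOn m ((unitSphere E ×ˢ I) ×ˢ I))
    (hbm : ∀ x, ‖x‖ = 1 → ∀ τ ∈ I, m ((x, 0), τ) = b (x, τ))
    (hum : ∀ x, ‖x‖ = 1 → ∀ τ ∈ I, m ((x, 1), τ) = u (x, τ))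
    {H₁ : E × ℝ → W} (hH₁ : Continuous H₁) (hb₁ : ∀ x, ‖x‖ ≤ 1 → H₁ (x, 0) = b (x, 1))
    (hu₁ : ∀ x, ‖x‖ ≤ 1 → H₁ (x, 1) = u (x, 1))
    (hm₁ : ∀ x, ‖x‖ = 1 → ∀ t ∈ I, H₁ (x, t) = m ((x, t), 1)) :
    ∃ H : E × ℝ → W, Continuous H ∧ (∀ x, ‖x‖ ≤ 1 → H (x, 0) = b (x, 0)) ∧
      (∀ x, ‖x‖ ≤ 1 → H (x, 1) = u (x, 0)) ∧
      ∀ x, ‖x‖ = 1 → ∀ t ∈ I, H (x, t) = m ((x, t), 0) := by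
  obtain ⟨q, hq, q_bot, q_top, q_side⟩ := exists_glue_prism hb hu hm hbm hum
  obtain ⟨H, hH, hHq⟩ := exists_extension_of_homotopy hq
    ⟨fun z => H₁ (z.1, (z.2 + 1) / 2), by fun_prop, by
      rintro ⟨x, r⟩ hz
      rcases norm_prod_eq_one.1 hz with ⟨hx, rfl | rfl⟩ | ⟨hx, h₀, h₁⟩
      · simp [q_bot, hb₁ x hx]
      · simp [q_top, hu₁ x hx]
      · have ht : (r + 1) / 2 ∈ I := ⟨by linarith, by linarith⟩
        refine (hm₁ x hx _ ht).trans ?_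
        rw [← q_side x hx _ ht 1 (by simp)]
        congr 3
        ring⟩
  refine ⟨fun z => H (z.1, 2 * z.2 - 1), by fun_prop, fun x hx => ?_, fun x hx => ?_,
    fun x hx t ht => ?_⟩
  · have h := hHq (x, -1) (norm_prod_eq_one.2 (.inl ⟨hx, .inl rfl⟩))
    simpa [q_bot] using h
  · have h := hHq (x, 1) (norm_prod_eq_one.2 (.inl ⟨hx, .inr rfl⟩))
    norm_num [q_top] at h ⊢
    exact h
  · rw [← q_side x hx t ht 0 (by simp)]
    exact hHq _ (norm_prod_eq_one.2 (.inr ⟨hx, by linarith [ht.1], by linarith [ht.2]⟩))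

lemma HasLift.of_homotopy {f : Y → Z} (hf : Continuous f) {y : E × ℝ → Y} {h : (E × ℝ) × ℝ → Z}
    {s : E → Z} (hy : ContinuousOn y (unitSphere E ×ˢ I))
    (hh : ContinuousOn h ((unitSphere E ×ˢ I) ×ˢ I)) (hs : Continuous s)
    (hhy : ∀ x, ‖x‖ = 1 → ∀ τ ∈ I, h ((x, 0), τ) = f (y (x, τ)))
    (hhs : ∀ x, ‖x‖ = 1 → h ((x, 1), 0) = s x)
    (H : ∀ s₁ : E → Z, Continuous s₁ → (∀ x, ‖x‖ = 1 → h ((x, 1), 1) = s₁ x) →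
      HasLift f (fun x => y (x, 1)) (fun z => h (z, 1)) s₁) :
    HasLift f (fun x => y (x, 0)) (fun z => h (z, 0)) s := by
  have hh₁ : ContinuousOn (fun z : E × ℝ => h ((z.1, 1), z.2)) (unitSphere E ×ˢ I) :=
    hh.comp (by fun_prop) fun z hz => ⟨⟨hz.1, by simp⟩, hz.2⟩
  obtain ⟨S, hS, hS₀, hSh⟩ := exists_homotopy_extension hs hh₁ hhs
  obtain ⟨g₁, H₁, hg₁, hH₁, hgy₁, H₁_bot, H₁_top, H₁_side⟩ :=
    H (fun x => S (x, 1)) (by fun_prop) fun x hx => (hSh x hx 1 (by simp)).symm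
  obtain ⟨g, hg, hg₀, hgy⟩ := exists_homotopy_extension hg₁ (continuousOn_comp_one_sub hy)
    fun x hx => by simp [hgy₁ x hx]
  obtain ⟨H₀, hH₀, H₀_bot, H₀_top, H₀_side⟩ := exists_prism_extension_of_homotopy
    (b := fun z => f (g (z.1, 1 - z.2))) (by fun_prop) hS hh
    (fun x hx τ hτ => by
      rw [hhy x hx τ hτ, hgy x hx _ (Icc.mem_iff_one_sub_mem.1 hτ), sub_sub_cancel])
    (fun x hx τ hτ => (hSh x hx τ hτ).symm) hH₁
    (fun x hx => by simp [H₁_bot x hx, hg₀ x hx]) H₁_top H₁_side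
  exact ⟨fun x => g (x, 1), H₀, by fun_prop, hH₀, fun x hx => by simp [hgy x hx],
    fun x hx => by simp [H₀_bot x hx], fun x hx => by rw [H₀_top x hx, hS₀ x hx], H₀_side⟩

/-- Homotopy relative to the unit sphere of maps defined on the closed unit ball. -/
def BallHomotopic (u v : E → W) : Prop :=
  ∃ G : E × ℝ → W, Continuous G ∧ (∀ x, ‖x‖ ≤ 1 → G (x, 0) = u x) ∧
    (∀ x, ‖x‖ ≤ 1 → G (x, 1) = v x) ∧ ∀ x, ‖x‖ = 1 → ∀ t ∈ I, G (x, t) = u x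

/-- Injectivity of `f` on homotopy groups, at the constant class: a spheroid modelled on the ball of
`E` whose image under `f` is null-homotopic is itself null-homotopic. -/
def InjBall (f : Y → Z) (E : Type*) [NormedAddCommGroup E] : Prop :=
  ∀ (y₀ : Y) (g : E → Y), Continuous g → (∀ x, ‖x‖ = 1 → g x = y₀) →
    BallHomotopic (f ∘ g) (fun _ => f y₀) → BallHomotopic g fun _ => y₀

/-- Surjectivity of `f` on homotopy groups: every spheroid modelled on the ball of `E` and based at
`f y₀` comes, up to homotopy, from a spheroid based at `y₀`. -/
def SurjBall (f : Y → Z) (E : Type*) [NormedAddCommGroup E] : Prop :=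
  ∀ (y₀ : Y) (s : E → Z), Continuous s → (∀ x, ‖x‖ = 1 → s x = f y₀) →
    HasLift f (fun _ => y₀) (fun _ => f y₀) s

/-- A deformation of the sphere of `E × ℝ` which at time `1` collapses everything but the open top
face to the bottom. -/
noncomputable def sphereCollapse (z : (E × ℝ) × ℝ) : E × ℝ :=
  let q := max ((1 + 3 * z.2) * ‖z.1.1‖ - 1) (3 * z.2 * (1 - z.1.2) / 2)
  (max 0 (min 1 (2 + z.1.2 - q)) • ballRetract ((1 + 3 * z.2) • z.1.1), max (-1) (z.1.2 - q))

lemma continuous_sphereCollapse : Continuous (sphereCollapse : (E × ℝ) × ℝ → E × ℝ) := by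
  unfold sphereCollapse
  fun_prop

lemma sphereCollapse_zero {z : E × ℝ} (hz : ‖z‖ = 1) : sphereCollapse (z, 0) = z := by
  obtain ⟨x, r⟩ := z
  have hx : ‖x‖ ≤ 1 := (norm_fst_le (x, r)).trans hz.le
  have hr : -1 ≤ r := (abs_le.1 ((norm_snd_le (x, r)).trans hz.le)).1
  have h₁ : (1 : ℝ) ≤ 2 + r := by linarith
  simp [sphereCollapse, hx, ballRetract_of_le, hr, h₁]

lemma sphereCollapse_one {x : E} {r : ℝ} (hr : r ≤ 1) (h : ‖x‖ = 1 ∨ r = -1) :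
    sphereCollapse ((x, r), 1) = (0, -1) := by
  have hq : 3 ≤ max ((1 + 3 * 1) * ‖x‖ - 1) (3 * 1 * (1 - r) / 2) := by
    rcases h with h | h
    · exact le_max_of_le_left (by norm_num [h])
    · exact le_max_of_le_right (by norm_num [h])
  simp only [sphereCollapse]
  rw [max_eq_left (a := (0 : ℝ)) ((min_le_right _ _).trans (by linarith)),
    max_eq_left (a := (-1 : ℝ)) (by linarith), zero_smul]

lemma norm_sphereCollapse {z : E × ℝ} (hz : ‖z‖ = 1) {t : ℝ} (ht : t ∈ I) :
    ‖sphereCollapse (z, t)‖ = 1 := by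
  obtain ⟨x, r⟩ := z
  have hn : ‖(1 + 3 * t) • x‖ = (1 + 3 * t) * ‖x‖ := by
    rw [norm_smul, Real.norm_eq_abs, abs_of_nonneg (by linarith [ht.1])]
  simp only [sphereCollapse]
  set q := max ((1 + 3 * t) * ‖x‖ - 1) (3 * t * (1 - r) / 2) with hq
  have hr := abs_le.1 ((norm_snd_le (x, r)).trans hz.le)
  have hq₀ : 0 ≤ q := le_max_of_le_right (by have := mul_nonneg ht.1 (sub_nonneg.2 hr.2); linarith)
  rw [norm_prod_eq_one, norm_smul, norm_ballRetract, hn, Real.norm_eq_abs,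
    abs_of_nonneg (le_max_left _ _)]
  rcases le_total (r - q) (-1) with hrq | hrq
  · refine .inl ⟨mul_le_one₀ (by simp) ?_ (min_le_right _ _), .inl (max_eq_left hrq)⟩
    have := mul_nonneg (by linarith [ht.1] : 0 ≤ 1 + 3 * t) (norm_nonneg x)
    exact le_min this zero_le_one
  rw [min_eq_left (b := 2 + r - q) (by linarith), max_eq_right zero_le_one, one_mul,
    max_eq_right hrq]
  rcases le_or_gt 1 ((1 + 3 * t) * ‖x‖) with hx | hx
  · exact .inr ⟨min_eq_right hx, hrq, by linarith [hr.2]⟩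
  have hx₁ : ‖x‖ < 1 := by nlinarith [mul_nonneg ht.1 (norm_nonneg x)]
  refine .inl ⟨min_le_right _ _, ?_⟩
  rcases norm_prod_eq_one.1 hz with ⟨-, rfl | rfl⟩ | ⟨hx', -⟩
  · exact .inl (by linarith)
  · exact .inr (by rw [hq, sub_self, mul_zero, zero_div, max_eq_right (by linarith), sub_zero])
  · exact absurd hx' hx₁.ne

/-- The top face carries a spheroid which `f` sends to a null-homotopic one. -/
lemma InjBall.exists_extension_of_eq_const {f : Y → Z} (hI : InjBall f E) {y : E × ℝ → Y} {y₀ : Y}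
    (hy : ContinuousOn y (unitSphere (E × ℝ))) (hy_bot : ∀ x, ‖x‖ ≤ 1 → y (x, -1) = y₀)
    (hy_side : ∀ x r, ‖x‖ = 1 → -1 ≤ r → r ≤ 1 → y (x, r) = y₀)
    (hfy : ∃ s : E × ℝ → Z, Continuous s ∧ ∀ z, ‖z‖ = 1 → s z = f (y z)) :
    ∃ g : E × ℝ → Y, Continuous g ∧ ∀ z, ‖z‖ = 1 → g z = y z := by
  obtain ⟨s, hs, hsy⟩ := hfy
  have norm_face {x : E} (hx : ‖x‖ ≤ 1) {r : ℝ} (hr : r = -1 ∨ r = 1) : ‖(x, r)‖ = 1 :=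
    norm_prod_eq_one.2 (.inl ⟨hx, hr⟩)
  let w (x : E) : Y := y (ballRetract x, 1)
  have hw : Continuous w := hy.comp_continuous (f := fun x => (ballRetract x, 1)) (by fun_prop)
    fun x => norm_face (norm_ballRetract_le x) (.inr rfl)
  have hwy {x : E} (hx : ‖x‖ ≤ 1) : w x = y (x, 1) := by simp only [w, ballRetract_of_le hx]
  have hwS (x : E) (hx : ‖x‖ = 1) : w x = y₀ := by
    rw [hwy hx.le, hy_side x 1 hx (by norm_num) le_rfl]
  have hnull : BallHomotopic (f ∘ w) fun _ => f y₀ := by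
    refine ⟨fun z => s (z.1, 1 - 2 * z.2), by fun_prop, fun x hx => ?_, fun x hx => ?_,
      fun x hx t ht => ?_⟩
    · simp [hsy _ (norm_face hx (.inr rfl)), hwy hx]
    · norm_num [hsy _ (norm_face hx (.inl rfl)), hy_bot x hx]
    · have hr : -1 ≤ 1 - 2 * t ∧ 1 - 2 * t ≤ 1 := ⟨by linarith [ht.2], by linarith [ht.1]⟩
      simp [hsy _ (norm_prod_eq_one.2 (.inr ⟨hx, hr⟩)), hy_side x _ hx hr.1 hr.2, hwS x hx]
  obtain ⟨N, hN, hN₀, hN₁, hNS⟩ := hI y₀ w hw hwS hnull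
  refine ⟨fun z => N (z.1, (1 - z.2) / 2), by fun_prop, fun ⟨x, r⟩ hz => ?_⟩
  rcases norm_prod_eq_one.1 hz with ⟨hx, rfl | rfl⟩ | ⟨hx, h₀, h₁⟩
  · norm_num [hN₁ x hx, hy_bot x hx]
  · simp [hN₀ x hx, hwy hx]
  · exact (hNS x hx _ ⟨by linarith, by linarith⟩).trans
      ((hwS x hx).trans (hy_side x r hx h₀ h₁).symm)

lemma InjBall.exists_extension {f : Y → Z} (hf : Continuous f) (hI : InjBall f E) {y : E × ℝ → Y}
    (hy : ContinuousOn y (unitSphere (E × ℝ)))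
    (hfy : ∃ s : E × ℝ → Z, Continuous s ∧ ∀ z, ‖z‖ = 1 → s z = f (y z)) :
    ∃ g : E × ℝ → Y, Continuous g ∧ ∀ z, ‖z‖ = 1 → g z = y z := by
  obtain ⟨s, hs, hsy⟩ := hfy
  have hyΨ : ContinuousOn (y ∘ sphereCollapse) (unitSphere (E × ℝ) ×ˢ I) :=
    hy.comp continuous_sphereCollapse.continuousOn fun z hz => norm_sphereCollapse hz.1 hz.2
  have extension_one : ∃ s₁ : E × ℝ → Z, Continuous s₁ ∧
      ∀ z, ‖z‖ = 1 → s₁ z = f (y (sphereCollapse (z, 1))) := by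
    simpa using exists_extension_of_homotopy
      (continuousOn_comp_one_sub (hf.comp_continuousOn hyΨ))
      ⟨s, hs, fun z hz => by simp [hsy z hz, sphereCollapse_zero hz]⟩
  obtain ⟨g, hg, hgy⟩ := exists_extension_of_homotopy hyΨ
    (hI.exists_extension_of_eq_const (y₀ := y (0, -1))
      (hyΨ.comp (f := fun z => (z, 1)) (by fun_prop) fun z hz => ⟨hz, by simp⟩)
      (fun x _ => by simp [sphereCollapse_one])
      (fun x r hx _ hr => by simp [sphereCollapse_one hr (.inl hx)]) extension_one)
  exact ⟨g, hg, fun z hz => by simp [hgy z hz, sphereCollapse_zero hz]⟩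

theorem hasLift_prod {f : Y → Z} (hf : Continuous f) (hI : InjBall f E) (hS : SurjBall f (E × ℝ))
    {y : E × ℝ → Y} {h : (E × ℝ) × ℝ → Z} {s : E × ℝ → Z}
    (hy : ContinuousOn y (unitSphere (E × ℝ))) (hh : ContinuousOn h (unitSphere (E × ℝ) ×ˢ I))
    (hs : Continuous s) (hhy : ∀ z, ‖z‖ = 1 → h (z, 0) = f (y z))
    (hhs : ∀ z, ‖z‖ = 1 → h (z, 1) = s z) : HasLift f y h s := by
  obtain ⟨s₀, hs₀, hsy⟩ := exists_extension_of_homotopy hh ⟨s, hs, fun z hz => (hhs z hz).symm⟩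
  obtain ⟨g, hg, hgy⟩ := hI.exists_extension hf hy
    ⟨s₀, hs₀, fun z hz => (hsy z hz).trans (hhy z hz)⟩
  have contract (s₁ : E × ℝ → Z) (hs₁ : Continuous s₁) (hgs : ∀ z, ‖z‖ = 1 → f (g z) = s₁ z) :
      HasLift f g (fun z => f (g z.1)) s₁ := by
    refine (HasLift.of_homotopy hf (y := fun z => g ((1 - z.2) • z.1))
      (h := fun z => f (g ((1 - z.2) • z.1.1))) (by fun_prop) (by fun_prop) hs₁ (by simp)
      (by simpa using hgs) fun s₂ hs₂ h₂ => ?_).congr (by simp) (by simp)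
    simpa using hS (g 0) s₂ hs₂ fun z hz => by simpa using (h₂ z hz).symm
  refine (HasLift.of_homotopy hf (y := fun z => g z.1) (h := fun z => h (z.1.1, (1 - z.2) * z.1.2))
    (by fun_prop) (hh.comp (by fun_prop) fun z hz => ⟨hz.1.1,
      unitInterval.mul_mem (Icc.mem_iff_one_sub_mem.1 hz.2) hz.1.2⟩) hs
    (fun z hz => by simp [hhy z hz, hgy z hz]) (by simpa using hhs)
    fun s₁ hs₁ h₁ => ?_).congr hgy (by simp)
  refine (contract s₁ hs₁ fun z hz => ?_).congr (by simp) fun z hz t _ => ?_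
  · simpa [hhy z hz, hgy z hz] using h₁ z hz
  · simp [hhy z hz, hgy z hz]

end Balls

/-! ### Weak homotopy equivalences lift on balls -/

section Cubes

open Set unitInterval

variable {W : Type*} [TopologicalSpace W] {n : ℕ}

/-- The map from `ℝⁿ` to the unit cube that identifies the unit ball of the sup norm with it. -/
noncomputable def toCube (x : Fin n → ℝ) : Fin n → I :=
  fun i => projIcc 0 1 zero_le_one ((x i + 1) / 2)

/-- The identification of the unit cube with the unit ball of the sup norm. -/
noncomputable def ofCube (t : Fin n → I) : Fin n → ℝ := fun i => 2 * (t i : ℝ) - 1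

@[fun_prop]
lemma continuous_toCube : Continuous (toCube (n := n)) :=
  continuous_pi fun i => continuous_projIcc.comp (by fun_prop)

@[fun_prop]
lemma continuous_ofCube : Continuous (ofCube (n := n)) := by
  unfold ofCube
  fun_prop

lemma ofCube_toCube {x : Fin n → ℝ} (hx : ‖x‖ ≤ 1) : ofCube (toCube x) = x := by
  funext i
  have h := abs_le.1 ((norm_le_pi_norm x i).trans hx)
  have : (x i + 1) / 2 ∈ I := ⟨by linarith, by linarith⟩
  simp only [ofCube, toCube, projIcc_of_mem _ this]
  ring

lemma toCube_ofCube (t : Fin n → I) : toCube (ofCube t) = t := by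
  funext i
  simp [toCube, ofCube]

lemma norm_ofCube_le (t : Fin n → I) : ‖ofCube t‖ ≤ 1 :=
  (pi_norm_le_iff_of_nonneg zero_le_one).2 fun i => abs_le.2 (by
    obtain ⟨h₀, h₁⟩ := (t i).2
    constructor <;> simp only [ofCube] <;> linarith)

lemma norm_ofCube_of_mem_boundary {t : Fin n → I} (ht : t ∈ Cube.boundary (Fin n)) :
    ‖ofCube t‖ = 1 := by
  obtain ⟨i, hi⟩ := ht
  have h : ‖ofCube t i‖ = 1 := by rcases hi with hi | hi <;> norm_num [ofCube, hi]
  exact (norm_ofCube_le t).antisymm (h.symm.trans_le (norm_le_pi_norm _ i))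

lemma toCube_mem_boundary {x : Fin n → ℝ} (hx : ‖x‖ = 1) : toCube x ∈ Cube.boundary (Fin n) := by
  obtain ⟨i, hi⟩ : ∃ i, 1 ≤ |x i| := by
    by_contra! h
    exact ((pi_norm_lt_iff zero_lt_one).2 h).ne hx
  refine ⟨i, (le_abs.1 hi).symm.imp (fun h => ?_) fun h => ?_⟩
  · exact projIcc_of_le_left _ (by linarith)
  · exact projIcc_of_right_le _ (by linarith)

lemma ballHomotopic_iff_homotopic {w : W} {p q : GenLoop (Fin n) W w} {u v : (Fin n → ℝ) → W}
    (hp : ∀ t, p t = u (ofCube t)) (hq : ∀ t, q t = v (ofCube t)) :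
    BallHomotopic u v ↔ GenLoop.Homotopic p q := by
  refine ⟨fun ⟨G, hG, G₀, G₁, GS⟩ => ⟨⟨⟨⟨fun z => G (ofCube z.2, z.1), by fun_prop⟩,
    fun t => (G₀ _ (norm_ofCube_le t)).trans (hp t).symm,
    fun t => (G₁ _ (norm_ofCube_le t)).trans (hq t).symm⟩,
    fun r t ht => (GS _ (norm_ofCube_of_mem_boundary ht) r r.2).trans (hp t).symm⟩⟩, fun ⟨H⟩ => ?_⟩
  refine ⟨fun z => H (projIcc 0 1 zero_le_one z.2, toCube z.1),
    H.continuous.comp ((continuous_projIcc.comp continuous_snd).prodMk (by fun_prop)),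
    fun x hx => ?_, fun x hx => ?_, fun x hx t _ => ?_⟩
  · simp [hp, ofCube_toCube hx]
  · simp [hq, ofCube_toCube hx]
  · exact (H.eq_fst _ (toCube_mem_boundary hx)).trans ((hp _).trans (by rw [ofCube_toCube hx.le]))

/-- The generalized loop given by a map on the ball that is constant on the sphere. -/
noncomputable def genLoopOfBall {w : W} (g : (Fin n → ℝ) → W) (hg : Continuous g)
    (h : ∀ x, ‖x‖ = 1 → g x = w) : GenLoop (Fin n) W w :=
  ⟨⟨fun t => g (ofCube t), by fun_prop⟩, fun _ ht => h _ (norm_ofCube_of_mem_boundary ht)⟩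

lemma ballHomotopic_of_joined {u v : (Fin 0 → ℝ) → W} (h : Joined (u 0) (v 0)) :
    BallHomotopic u v := by
  obtain ⟨γ⟩ := h
  refine ⟨fun z => γ.extend z.2, by fun_prop, fun x _ => ?_, fun x _ => ?_, fun x hx => ?_⟩
  · simp [Subsingleton.elim x 0]
  · simp [Subsingleton.elim x 0]
  · simp [norm_of_subsingleton] at hx

/-- Every lifting problem against `f` on the unit ball of `E` is solvable. -/
def LiftsBall {Y Z : Type*} [TopologicalSpace Y] [TopologicalSpace Z] (f : Y → Z) (E : Type*)
    [NormedAddCommGroup E] : Prop :=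
  ∀ ⦃y : E → Y⦄ ⦃h : E × ℝ → Z⦄ ⦃s : E → Z⦄, ContinuousOn y (unitSphere E) →
    ContinuousOn h (unitSphere E ×ˢ I) → Continuous s → (∀ x, ‖x‖ = 1 → h (x, 0) = f (y x)) →
    (∀ x, ‖x‖ = 1 → h (x, 1) = s x) → HasLift f y h s

lemma HasLift.of_linearIsometryEquiv {Y Z E E' : Type*} [TopologicalSpace Y] [TopologicalSpace Z]
    [NormedAddCommGroup E] [NormedSpace ℝ E] [NormedAddCommGroup E'] [NormedSpace ℝ E']
    (e : E ≃ₗᵢ[ℝ] E') {f : Y → Z} {y : E' → Y} {h : E' × ℝ → Z} {s : E' → Z}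
    (H : HasLift f (fun x => y (e x)) (fun z => h (e z.1, z.2)) fun x => s (e x)) :
    HasLift f y h s := by
  obtain ⟨g, G, hg, hG, hgy, G₀, G₁, GS⟩ := H
  refine ⟨fun x => g (e.symm x), fun z => G (e.symm z.1, z.2), by fun_prop, by fun_prop,
    fun x hx => ?_, fun x hx => ?_, fun x hx => ?_, fun x hx t ht => ?_⟩
  · simp [hgy (e.symm x) (by simpa)]
  · simp [G₀ (e.symm x) (by simpa)]
  · simp [G₁ (e.symm x) (by simpa)]
  · simp [GS (e.symm x) (by simpa) t ht]

/-- `ℝⁿ × ℝ ≃ ℝⁿ⁺¹`, for the sup norms. -/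
def prodPiFinSuccIsometry (n : ℕ) : ((Fin n → ℝ) × ℝ) ≃ₗᵢ[ℝ] (Fin (n + 1) → ℝ) where
  toLinearEquiv := LinearEquiv.prodComm ℝ (Fin n → ℝ) ℝ ≪≫ₗ Fin.consLinearEquiv ℝ fun _ => ℝ
  norm_map' z := by
    have h : ‖(Fin.cons z.2 z.1 : Fin (n + 1) → ℝ)‖₊ = ‖z‖₊ := eq_of_forall_ge_iff fun r => by
      simp [pi_nnnorm_le_iff, Prod.nnnorm_def, Fin.forall_fin_succ, and_comm]
    exact congrArg NNReal.toReal h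

namespace IsWeakHomotopyEquiv

variable {Y Z : Type u} [TopologicalSpace Y] [TopologicalSpace Z] {f : C(Y, Z)}

lemma injBall_zero (hf : IsWeakHomotopyEquiv f) : InjBall f (Fin 0 → ℝ) := by
  rintro y₀ g _ - ⟨G, hG, G₀, G₁, -⟩
  have h₀ : ‖(0 : Fin 0 → ℝ)‖ ≤ 1 := norm_zero.trans_le zero_le_one
  exact ballHomotopic_of_joined <| Quotient.exact <| hf.1.1 <| Quotient.sound
    ⟨⟨⟨fun t => G (0, t), by fun_prop⟩, G₀ 0 h₀, G₁ 0 h₀⟩⟩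

lemma injBall_succ (hf : IsWeakHomotopyEquiv f) (n : ℕ) : InjBall f (Fin (n + 1) → ℝ) := by
  intro y₀ g hg hgS h
  let p := genLoopOfBall g hg hgS
  have hp : GenLoop.Homotopic (genLoopMap f p) (genLoopMap f GenLoop.const) :=
    (ballHomotopic_iff_homotopic (fun _ => rfl) fun _ => rfl).1 h
  exact (ballHomotopic_iff_homotopic (p := p) (fun _ => rfl) fun _ => rfl).2
    (Quotient.exact ((hf.2 n y₀).1 (Quotient.sound hp)))

lemma surjBall_succ (hf : IsWeakHomotopyEquiv f) (n : ℕ) : SurjBall f (Fin (n + 1) → ℝ) := by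
  intro y₀ s hs hsS
  obtain ⟨p, hp⟩ := (hf.2 n y₀).2 (Quotient.mk _ (genLoopOfBall s hs hsS))
  induction p using Quotient.inductionOn with | _ p
  have hps : GenLoop.Homotopic (genLoopMap f p) (genLoopOfBall s hs hsS) := Quotient.exact hp
  obtain ⟨G, hG, G₀, G₁, GS⟩ := (ballHomotopic_iff_homotopic (u := fun x => f (p (toCube x)))
    (v := s) (fun t => by rw [toCube_ofCube]; rfl) fun _ => rfl).2 hps
  have hpS (x : Fin (n + 1) → ℝ) (hx : ‖x‖ = 1) : p (toCube x) = y₀ :=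
    p.2 _ (toCube_mem_boundary hx)
  exact ⟨fun x => p (toCube x), G, p.1.continuous.comp continuous_toCube, hG, hpS, G₀, G₁,
    fun x hx t ht => (GS x hx t ht).trans (congrArg f (hpS x hx))⟩

lemma liftsBall_zero (hf : IsWeakHomotopyEquiv f) : LiftsBall f (Fin 0 → ℝ) := by
  intro y h s _ _ _ _ _
  obtain ⟨p, hp⟩ := hf.1.2 (Quotient.mk _ (s 0))
  induction p using Quotient.inductionOn with | _ p
  obtain ⟨G, hG, G₀, G₁, -⟩ := ballHomotopic_of_joined (u := fun _ => f p) (Quotient.exact hp)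
  have sphere_empty (x : Fin 0 → ℝ) : ‖x‖ ≠ 1 := by simp [norm_of_subsingleton]
  exact ⟨fun _ => p, G, continuous_const, hG, fun x hx => absurd hx (sphere_empty x), G₀, G₁,
    fun x hx => absurd hx (sphere_empty x)⟩

lemma liftsBall_succ (hf : IsWeakHomotopyEquiv f) (n : ℕ) : LiftsBall f (Fin (n + 1) → ℝ) := by
  intro y h s hy hh hs hhy hhs
  let e := prodPiFinSuccIsometry n
  have hI : InjBall f (Fin n → ℝ) := by
    cases n with
    | zero => exact hf.injBall_zero
    | succ n => exact hf.injBall_succ n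
  have hS : SurjBall f ((Fin n → ℝ) × ℝ) := fun y₀ s hs hsS =>
    .of_linearIsometryEquiv e.symm (hf.surjBall_succ n y₀ _ (by fun_prop)
      fun x hx => hsS _ ((e.symm.norm_map x).trans hx))
  have norm_e {z} (hz : ‖z‖ = 1) : ‖e z‖ = 1 := (e.norm_map z).trans hz
  exact .of_linearIsometryEquiv e (hasLift_prod f.continuous hI hS
    (hy.comp e.continuous.continuousOn fun z => norm_e)
    (hh.comp (by fun_prop) fun z hz => ⟨norm_e hz.1, hz.2⟩) (by fun_prop)
    (fun z hz => hhy _ (norm_e hz)) fun z hz => hhs _ (norm_e hz))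

theorem liftsBall (hf : IsWeakHomotopyEquiv f) : (n : ℕ) → LiftsBall f (Fin n → ℝ)
  | 0 => hf.liftsBall_zero
  | n + 1 => hf.liftsBall_succ n

end IsWeakHomotopyEquiv

end Cubes

/-! ### Mapping path spaces -/

section MappingPath

open Set unitInterval

variable {Y Z : Type u} [TopologicalSpace Y] [TopologicalSpace Z]

/-- The mapping path space of `f`: points of `Y` with a path in `Z` that starts at the image. -/
abbrev MappingPath (f : C(Y, Z)) : Type u := {p : Y × C(I, Z) // p.2 0 = f p.1}

namespace MappingPath

variable (f : C(Y, Z))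

/-- The projection of the mapping path space to `Y`. -/
def source : C(MappingPath f, Y) := ⟨fun p => p.1.1, by fun_prop⟩

/-- The fibration of the mapping path space over `Z`: the end point of the path. -/
def target : C(MappingPath f, Z) := ⟨fun p => p.1.2 1, by fun_prop⟩

/-- The inclusion of `Y` into the mapping path space by constant paths. -/
def const : C(Y, MappingPath f) := ⟨fun y => ⟨(y, ContinuousMap.const _ (f y)), rfl⟩, by
  refine (continuous_id.prodMk ?_).subtype_mk _
  exact ContinuousMap.continuous_const'.comp f.continuous⟩

lemma const_comp_source_homotopic :
    ((const f).comp (source f)).Homotopic (ContinuousMap.id (MappingPath f)) := by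
  refine ⟨⟨⟨fun z => ⟨(z.2.1.1, ⟨fun t => z.2.1.2 (z.1 * t), by fun_prop⟩), by simpa using z.2.2⟩,
    ?_⟩, fun p => ?_, fun p => ?_⟩⟩
  · refine Continuous.subtype_mk (Continuous.prodMk (by fun_prop) ?_) _
    refine ContinuousMap.continuous_of_continuous_uncurry _ ?_
    change Continuous fun q : (unitInterval × MappingPath f) × unitInterval =>
      q.1.2.1.2 (q.1.1 * q.2)
    fun_prop
  · exact Subtype.ext (Prod.ext rfl (ContinuousMap.ext fun t => by simp [const, source, p.2]))
  · exact Subtype.ext (Prod.ext rfl (ContinuousMap.ext fun t => by simp))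

/-- The inclusion of `Y` by constant paths as a homotopy equivalence. -/
def homotopyEquiv : ContinuousMap.HomotopyEquiv Y (MappingPath f) where
  toFun := const f
  invFun := source f
  left_inv := .refl _
  right_inv := const_comp_source_homotopic f

variable {f}

lemma exists_lift_ball {E : Type*} [NormedAddCommGroup E] [NormedSpace ℝ E]
    (hf : LiftsBall f E) {a : E → MappingPath f} {s : E → Z} (ha : ContinuousOn a (unitSphere E))
    (hs : Continuous s) (has : ∀ x, ‖x‖ = 1 → target f (a x) = s x) :
    ∃ g : E → MappingPath f, Continuous g ∧ (∀ x, ‖x‖ = 1 → g x = a x) ∧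
      ∀ x, ‖x‖ ≤ 1 → target f (g x) = s x := by
  have path_continuousOn : ContinuousOn (fun z : E × ℝ => (a z.1).1.2) (unitSphere E ×ˢ I) :=
    (continuous_snd.comp continuous_subtype_val).comp_continuousOn
      (ha.comp continuousOn_fst fun z hz => hz.1)
  obtain ⟨g, H, hg, hH, hga, H₀, H₁, HS⟩ := hf (y := fun x => (a x).1.1)
    (h := fun z => (a z.1).1.2 (projIcc 0 1 zero_le_one z.2))
    ((source f).continuous.comp_continuousOn ha)
    (path_continuousOn.eval (continuous_projIcc.comp continuous_snd).continuousOn) hs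
    (fun x _ => by simpa using (a x).2) fun x hx => by simpa [target] using has x hx
  refine ⟨fun x => ⟨(g (ballRetract x), ⟨fun t => H (ballRetract x, t), by fun_prop⟩),
    H₀ _ (norm_ballRetract_le x)⟩, ?_, fun x hx => ?_, fun x hx => ?_⟩
  · refine Continuous.subtype_mk (Continuous.prodMk (by fun_prop) ?_) _
    exact ContinuousMap.continuous_of_continuous_uncurry _ (hH.comp (by fun_prop))
  · refine Subtype.ext (Prod.ext ?_ (ContinuousMap.ext fun t => ?_))
    · simpa [ballRetract_of_le hx.le] using hga x hx
    · simpa [ballRetract_of_le hx.le] using HS x hx t t.2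
  · simpa [ballRetract_of_le hx, target] using H₁ x hx

end MappingPath

end MappingPath

/-! ### Lifting on simplices -/

section Simplices

open Set

lemma exists_homeomorph_norm_lt_one_iff {ι E : Type*} [Finite ι] [NormedAddCommGroup E]
    [NormedSpace ℝ E] (b : AffineBasis ι ℝ E) :
    ∃ e : E ≃ₜ E, (∀ v, ‖e v‖ < 1 ↔ ∀ i, 0 < b.coord i v) ∧
      ∀ v, ‖e v‖ ≤ 1 ↔ ∀ i, 0 ≤ b.coord i v := by
  cases nonempty_fintype ι
  have hb : IsCompact (convexHull ℝ (range b)) := (finite_range b).isCompact_convexHull ℝ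
  obtain ⟨e, he, he', -⟩ := exists_homeomorph_image_interior_closure_frontier_eq_unitBall
    (convex_convexHull ℝ (range b)) ⟨_, b.centroid_mem_interior_convexHull⟩ hb.isBounded
  rw [b.interior_convexHull] at he
  rw [hb.isClosed.closure_eq, b.convexHull_eq_nonneg_coord] at he'
  refine ⟨e, fun v => ?_, fun v => ?_⟩
  · rw [← mem_ball_zero_iff, ← he, e.injective.mem_set_image, mem_ofPred_eq]
  · rw [← mem_closedBall_zero_iff, ← he', e.injective.mem_set_image, mem_ofPred_eq]

lemma exists_simplex_chart {ι E : Type*} [Fintype ι] [NormedAddCommGroup E] [NormedSpace ℝ E]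
    (b : AffineBasis ι ℝ E) :
    ∃ (φ : C(stdSimplex ℝ ι, E)) (ψ : C(E, stdSimplex ℝ ι)), (∀ x, ψ (φ x) = x) ∧
      (∀ x, ‖φ x‖ ≤ 1) ∧ (∀ x, (∃ i, x i = 0) → ‖φ x‖ = 1) ∧
      ∀ z, ‖z‖ = 1 → ∃ i, ψ z i = 0 := by
  have : FiniteDimensional ℝ E := b.finiteDimensional
  obtain ⟨e, e_lt, e_le⟩ := exists_homeomorph_norm_lt_one_iff b
  obtain ⟨c, hc⟩ : ∃ c : C(stdSimplex ℝ ι, E), ∀ x, c x = ∑ i, x i • b i :=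
    ⟨⟨fun x => ∑ i, x.1 i • b i, continuous_finsetSum _ fun i _ =>
      ((continuous_apply i).comp continuous_subtype_val).smul continuous_const⟩, fun _ => rfl⟩
  have coord_c (x : stdSimplex ℝ ι) (i : ι) : b.coord i (c x) = x i := by
    rw [hc, ← Finset.affineCombination_eq_linear_combination _ _ _ (stdSimplex.sum_eq_one x),
      b.coord_apply_combination_of_mem (Finset.mem_univ i) (stdSimplex.sum_eq_one x)]
  have norm_c (x) : ‖e (c x)‖ ≤ 1 := (e_le _).2 fun i => (x.2.1 i).trans_eq (coord_c x i).symm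
  have coord_nonneg (z : E) (i : ι) : 0 ≤ b.coord i (e.symm (ballRetract z)) :=
    (e_le _).1 (by simpa using norm_ballRetract_le z) i
  refine ⟨⟨fun x => e (c x), by fun_prop⟩, ⟨fun z => ⟨fun i => b.coord i (e.symm (ballRetract z)),
    coord_nonneg z, b.sum_coord_apply_eq_one _⟩, ?_⟩, fun x => ?_, norm_c, fun x ⟨i, hi⟩ => ?_,
    fun z hz => ?_⟩
  · exact Continuous.subtype_mk (continuous_pi fun i =>
      (continuous_barycentric_coord b i).comp (by fun_prop)) _
  · refine stdSimplex.ext (funext fun i => ?_)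
    change b.coord i (e.symm (ballRetract (e (c x)))) = x i
    rw [ballRetract_of_le (norm_c x), e.symm_apply_apply, coord_c]
  · refine (norm_c x).antisymm (not_lt.1 fun h => ?_)
    exact ((e_lt _).1 h i).ne' ((coord_c x i).trans hi)
  · by_contra! h
    have h_lt : ‖e (e.symm (ballRetract z))‖ < 1 :=
      (e_lt _).2 fun i => (coord_nonneg z i).lt_of_ne' (h i)
    rw [e.apply_symm_apply, ballRetract_of_le hz.le] at h_lt
    exact h_lt.ne hz

variable {n : ℕ}

lemma map_succAbove_apply (i : Fin (n + 2)) (x : stdSimplex ℝ (Fin (n + 1))) (k : Fin (n + 1)) :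
    stdSimplex.map i.succAbove x (i.succAbove k) = x k := by
  simp [FunOnFinite.linearMap_apply_apply, Finset.filter_eq']

lemma map_succAbove_apply_self (i : Fin (n + 2)) (x : stdSimplex ℝ (Fin (n + 1))) :
    stdSimplex.map i.succAbove x i = 0 := by
  simp [FunOnFinite.linearMap_apply_apply, Fin.succAbove_ne]

lemma map_succAbove_injective (i : Fin (n + 2)) :
    Function.Injective (stdSimplex.map (S := ℝ) i.succAbove) := fun x y h =>
  stdSimplex.ext <| funext fun k => by rw [← map_succAbove_apply i, h, map_succAbove_apply]

lemma exists_map_succAbove {i : Fin (n + 2)} {x : stdSimplex ℝ (Fin (n + 2))} (hx : x i = 0) :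
    ∃ y, stdSimplex.map i.succAbove y = x := by
  have sum_eq_one : ∑ k, x (i.succAbove k) = 1 := by
    rw [← stdSimplex.sum_eq_one x, Fin.sum_univ_succAbove _ i, hx, zero_add]
  refine ⟨⟨fun k => x (i.succAbove k), fun k => x.2.1 _, sum_eq_one⟩,
    stdSimplex.ext (funext fun k => ?_)⟩
  rcases Fin.eq_self_or_eq_succAbove i k with rfl | ⟨j, rfl⟩
  · exact (map_succAbove_apply_self _ _).trans hx.symm
  · exact map_succAbove_apply _ _ _

lemma exists_glue_faces {W : Type*} [TopologicalSpace W]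
    (a : Fin (n + 2) → C(stdSimplex ℝ (Fin (n + 1)), W))
    (ha : ∀ i j x y, stdSimplex.map i.succAbove x = stdSimplex.map j.succAbove y →
      a i x = a j y) :
    ∃ A : stdSimplex ℝ (Fin (n + 2)) → W, ContinuousOn A {x | ∃ i, x i = 0} ∧
      ∀ i x, A (stdSimplex.map i.succAbove x) = a i x := by
  obtain ⟨A, hA⟩ : ∃ A : stdSimplex ℝ (Fin (n + 2)) → W,
      ∀ i x, A (stdSimplex.map i.succAbove x) = a i x := by
    classical
    refine ⟨fun x => if h : ∃ p : Fin (n + 2) × stdSimplex ℝ (Fin (n + 1)),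
      stdSimplex.map p.1.succAbove p.2 = x then a h.choose.1 h.choose.2
        else a 0 (stdSimplex.vertex 0), fun i x => ?_⟩
    have h : ∃ p : Fin (n + 2) × stdSimplex ℝ (Fin (n + 1)),
      stdSimplex.map p.1.succAbove p.2 = stdSimplex.map i.succAbove x := ⟨(i, x), rfl⟩
    exact (dif_pos h).trans (ha _ _ _ _ h.choose_spec)
  refine ⟨A, continuousOn_iff_isClosed.2 fun t ht =>
    ⟨⋃ i, stdSimplex.map i.succAbove '' (a i ⁻¹' t), isClosed_iUnion_of_finite fun i =>
      ((ht.preimage (a i).continuous).isCompact.image (stdSimplex.continuous_map _)).isClosed, ?_⟩,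
    hA⟩
  ext x
  simp only [mem_inter_iff, mem_preimage, mem_ofPred_eq, mem_iUnion, mem_image]
  refine and_congr_left fun ⟨i, hi⟩ => ⟨fun hx => ?_, ?_⟩
  · obtain ⟨y, rfl⟩ := exists_map_succAbove hi
    exact ⟨i, y, by rwa [← hA], rfl⟩
  · rintro ⟨i, y, hy, rfl⟩
    rwa [hA]

lemma MappingPath.exists_lift_simplex {Y Z : Type u} [TopologicalSpace Y] [TopologicalSpace Z]
    {f : C(Y, Z)} (hf : LiftsBall f (Fin n → ℝ)) {a : stdSimplex ℝ (Fin (n + 1)) → MappingPath f}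
    {s : stdSimplex ℝ (Fin (n + 1)) → Z} (ha : ContinuousOn a {x | ∃ i, x i = 0})
    (hs : Continuous s) (has : ∀ x, (∃ i, x i = 0) → target f (a x) = s x) :
    ∃ g : C(stdSimplex ℝ (Fin (n + 1)), MappingPath f), (∀ x, (∃ i, x i = 0) → g x = a x) ∧
      ∀ x, target f (g x) = s x := by
  obtain ⟨b⟩ := AffineBasis.exists_affineBasis_of_finiteDimensional (ι := Fin (n + 1)) (k := ℝ)
    (P := Fin n → ℝ) (by simp)
  obtain ⟨φ, ψ, hψφ, norm_φ_le, norm_φ, hψ⟩ := exists_simplex_chart b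
  obtain ⟨g, hg, hga, hgs⟩ := exists_lift_ball hf (a := a ∘ ψ) (s := s ∘ ψ)
    (ha.comp ψ.continuous.continuousOn hψ) (hs.comp ψ.continuous) fun z hz => has _ (hψ z hz)
  refine ⟨⟨fun x => g (φ x), hg.comp φ.continuous⟩, fun x hx => ?_, fun x => ?_⟩
  · exact (hga _ (norm_φ x hx)).trans (congrArg a (hψφ x))
  · exact (hgs _ (norm_φ_le x)).trans (congrArg s (hψφ x))

end Simplices

/-! ### Trivial fibrations of singular simplicial sets -/

section TrivialFibration

open Simplicial

variable {n : ℕ} {P Q : TopCat.{u}}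

lemma exists_coord_ne_zero {ι : Type*} [Fintype ι] (x : stdSimplex ℝ ι) : ∃ i, x i ≠ 0 := by
  by_contra! h
  simpa [h] using stdSimplex.sum_eq_one x

lemma map_succAbove_ne {i j : Fin 2} (hij : i ≠ j) (x y : stdSimplex ℝ (Fin 1)) :
    stdSimplex.map i.succAbove x ≠ stdSimplex.map j.succAbove y := by
  intro h
  obtain ⟨k, hk⟩ := exists_coord_ne_zero (stdSimplex.map i.succAbove x)
  obtain rfl | rfl : k = i ∨ k = j := by omega
  · exact hk (map_succAbove_apply_self k x)
  · exact hk (h ▸ map_succAbove_apply_self k y)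

lemma map_succAbove_map {i j : Fin (n + 2)} (h : i ≤ j) (x : stdSimplex ℝ (Fin (n + 1))) :
    stdSimplex.map j.succ.succAbove (stdSimplex.map i.succAbove x) =
      stdSimplex.map i.castSucc.succAbove (stdSimplex.map j.succAbove x) := by
  rw [stdSimplex.map_comp_apply, stdSimplex.map_comp_apply]
  congr 1
  funext k
  exact congrArg (fun φ => φ.toOrderHom k) (SimplexCategory.δ_comp_δ h)

lemma exists_eq_map_succAbove_of_map_eq {i j : Fin (n + 2)} (h : i ≤ j)
    {x y : stdSimplex ℝ (Fin (n + 2))}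
    (hxy : stdSimplex.map i.castSucc.succAbove x = stdSimplex.map j.succ.succAbove y) :
    ∃ w, x = stdSimplex.map j.succAbove w ∧ y = stdSimplex.map i.succAbove w := by
  have hj : i.castSucc.succAbove j = j.succ :=
    Fin.succAbove_of_lt_succ _ _ (Fin.castSucc_lt_succ_iff.2 h)
  have hx : x j = 0 := by
    rw [← map_succAbove_apply i.castSucc, hj, hxy, map_succAbove_apply_self]
  obtain ⟨w, rfl⟩ := exists_map_succAbove hx
  refine ⟨w, rfl, map_succAbove_injective j.succ ?_⟩
  rw [← hxy, map_succAbove_map h]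

/-- Maps from a standard simplex to a singular simplicial set are continuous maps. -/
noncomputable def simplexMapEquiv :
    (Δ[n] ⟶ TopCat.toSSet.obj P) ≃ C(stdSimplex ℝ (Fin (n + 1)), P) :=
  SSet.yonedaEquiv.trans (TopCat.toSSetObjEquiv P (Opposite.op ⦋n⦌))

lemma simplexMapEquiv_δ (a : Δ[n + 1] ⟶ TopCat.toSSet.obj P) (i : Fin (n + 2))
    (x : stdSimplex ℝ (Fin (n + 1))) :
    simplexMapEquiv (SSet.stdSimplex.δ i ≫ a) x =
      simplexMapEquiv a (stdSimplex.map i.succAbove x) := by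
  dsimp only [simplexMapEquiv, Equiv.trans_apply]
  rw [SSet.stdSimplex.yonedaEquiv_δ_comp]
  exact TopCat.toSSetObjEquiv_δ_apply _ _ _

lemma simplexMapEquiv_map (a : Δ[n] ⟶ TopCat.toSSet.obj P) (p : P ⟶ Q)
    (x : stdSimplex ℝ (Fin (n + 1))) :
    simplexMapEquiv (a ≫ TopCat.toSSet.map p) x = p (simplexMapEquiv a x) := by
  dsimp only [simplexMapEquiv, Equiv.trans_apply]
  rw [SSet.yonedaEquiv_comp]
  rfl

/-- The continuous map on the `i`-th face given by a map from the boundary of a simplex. -/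
noncomputable def boundaryFace (a : (∂Δ[n + 1] : SSet.{u}) ⟶ TopCat.toSSet.obj P)
    (i : Fin (n + 2)) : C(stdSimplex ℝ (Fin (n + 1)), P) :=
  simplexMapEquiv (SSet.boundary.ι i ≫ a)

lemma boundary_δ_comp_ι {i j : Fin (n + 2)} (h : i ≤ j) :
    SSet.stdSimplex.δ j ≫ SSet.boundary.ι.{u} i.castSucc =
      SSet.stdSimplex.δ i ≫ SSet.boundary.ι.{u} j.succ := by
  rw [← cancel_mono (SSet.Subcomplex.ι _)]
  simp only [Category.assoc, SSet.boundary.ι_ι]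
  exact (SSet.stdSimplex.δ_comp_δ h).symm

lemma boundaryFace_map_of_le (a : (∂Δ[n + 2] : SSet.{u}) ⟶ TopCat.toSSet.obj P)
    {i j : Fin (n + 2)} (h : i ≤ j) (x : stdSimplex ℝ (Fin (n + 1))) :
    boundaryFace a i.castSucc (stdSimplex.map j.succAbove x) =
      boundaryFace a j.succ (stdSimplex.map i.succAbove x) := by
  simp only [boundaryFace, ← simplexMapEquiv_δ, ← Category.assoc, boundary_δ_comp_ι h]

lemma boundaryFace_eq_of_lt (a : (∂Δ[n + 1] : SSet.{u}) ⟶ TopCat.toSSet.obj P)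
    {i j : Fin (n + 2)} (hij : i < j) {x y : stdSimplex ℝ (Fin (n + 1))}
    (h : stdSimplex.map i.succAbove x = stdSimplex.map j.succAbove y) :
    boundaryFace a i x = boundaryFace a j y := by
  cases n with
  | zero => exact absurd h (map_succAbove_ne hij.ne x y)
  | succ n =>
    obtain ⟨i, rfl⟩ := Fin.exists_castSucc_eq.2 (Fin.ne_last_of_lt hij)
    obtain ⟨j, rfl⟩ := Fin.exists_succ_eq.2 (Fin.ne_zero_of_lt hij)
    have hij' : i ≤ j := Fin.castSucc_lt_succ_iff.1 hij
    obtain ⟨w, rfl, rfl⟩ := exists_eq_map_succAbove_of_map_eq hij' h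
    exact boundaryFace_map_of_le a hij' w

lemma boundaryFace_eq (a : (∂Δ[n + 1] : SSet.{u}) ⟶ TopCat.toSSet.obj P) (i j : Fin (n + 2))
    (x y : stdSimplex ℝ (Fin (n + 1)))
    (h : stdSimplex.map i.succAbove x = stdSimplex.map j.succAbove y) :
    boundaryFace a i x = boundaryFace a j y := by
  rcases lt_trichotomy i j with hij | rfl | hij
  · exact boundaryFace_eq_of_lt a hij h
  · rw [map_succAbove_injective i h]
  · exact (boundaryFace_eq_of_lt a hij h.symm).symm

lemma hasLift_boundary_of_exists {p : P ⟶ Q} {a : (∂Δ[n] : SSet.{u}) ⟶ TopCat.toSSet.obj P}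
    {b : Δ[n] ⟶ TopCat.toSSet.obj Q} (sq : CommSq a ∂Δ[n].ι (TopCat.toSSet.map p) b)
    (h : ∃ g : C(stdSimplex ℝ (Fin (n + 1)), P), ∂Δ[n].ι ≫ simplexMapEquiv.symm g = a ∧
      ∀ x, p (g x) = simplexMapEquiv b x) : sq.HasLift := by
  obtain ⟨g, hga, hgb⟩ := h
  refine ⟨⟨simplexMapEquiv.symm g, hga, simplexMapEquiv.injective ?_⟩⟩
  ext x
  rw [simplexMapEquiv_map, Equiv.apply_symm_apply, hgb]

variable {Y Z : Type u} [TopologicalSpace Y] [TopologicalSpace Z] {f : C(Y, Z)}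

lemma IsWeakHomotopyEquiv.hasLift_boundary_zero (hf : IsWeakHomotopyEquiv f)
    {a : (∂Δ[0] : SSet.{u}) ⟶ TopCat.toSSet.obj (.of (MappingPath f))}
    {b : Δ[0] ⟶ TopCat.toSSet.obj (.of Z)}
    (sq : CommSq a ∂Δ[0].ι (TopCat.toSSet.map (TopCat.ofHom (MappingPath.target f))) b) :
    sq.HasLift := by
  have no_boundary (x : stdSimplex ℝ (Fin 1)) : ¬ ∃ i, x i = 0 := by
    rintro ⟨i, hi⟩
    obtain ⟨k, hk⟩ := exists_coord_ne_zero x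
    exact hk (Subsingleton.elim i k ▸ hi)
  obtain ⟨y⟩ : Nonempty Y := by
    obtain ⟨c, -⟩ := hf.1.2 (Quotient.mk _ (simplexMapEquiv b (stdSimplex.vertex 0)))
    exact ⟨c.out⟩
  obtain ⟨g, -, hg⟩ := MappingPath.exists_lift_simplex (hf.liftsBall 0)
    (a := fun _ => MappingPath.const f y) continuousOn_const (simplexMapEquiv b).continuous
    fun x hx => absurd hx (no_boundary x)
  exact hasLift_boundary_of_exists sq ⟨g, SSet.boundary.hom_ext₀, hg⟩

lemma IsWeakHomotopyEquiv.hasLift_boundary_succ (hf : IsWeakHomotopyEquiv f)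
    {a : (∂Δ[n + 1] : SSet.{u}) ⟶ TopCat.toSSet.obj (.of (MappingPath f))}
    {b : Δ[n + 1] ⟶ TopCat.toSSet.obj (.of Z)}
    (sq : CommSq a ∂Δ[n + 1].ι (TopCat.toSSet.map (TopCat.ofHom (MappingPath.target f))) b) :
    sq.HasLift := by
  have target_face (i : Fin (n + 2)) (y : stdSimplex ℝ (Fin (n + 1))) :
      MappingPath.target f (boundaryFace a i y) =
        simplexMapEquiv b (stdSimplex.map i.succAbove y) := by
    rw [← simplexMapEquiv_δ, ← SSet.boundary.ι_ι_assoc, ← sq.w, ← Category.assoc,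
      simplexMapEquiv_map]
    rfl
  obtain ⟨A, hA, hAa⟩ := exists_glue_faces (boundaryFace a) (boundaryFace_eq a)
  obtain ⟨g, hga, hgb⟩ := MappingPath.exists_lift_simplex (hf.liftsBall (n + 1)) hA
    (simplexMapEquiv b).continuous fun x ⟨i, hi⟩ => by
      obtain ⟨y, rfl⟩ := exists_map_succAbove hi
      rw [hAa, target_face]
  refine hasLift_boundary_of_exists sq
    ⟨g, SSet.boundary.hom_ext fun i => simplexMapEquiv.injective ?_, hgb⟩
  ext x : 1
  rw [SSet.boundary.ι_ι_assoc, simplexMapEquiv_δ, Equiv.apply_symm_apply,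
    hga _ ⟨i, map_succAbove_apply_self i x⟩, hAa]
  rfl

lemma IsWeakHomotopyEquiv.rlp_target (hf : IsWeakHomotopyEquiv f) :
    SSet.modelCategoryQuillen.I.rlp
      (TopCat.toSSet.map (TopCat.ofHom (MappingPath.target f))) := by
  rintro _ _ _ ⟨n⟩
  refine ⟨fun {a b} sq => ?_⟩
  cases n with
  | zero => exact hf.hasLift_boundary_zero sq
  | succ n => exact hf.hasLift_boundary_succ sq

end TrivialFibration

/-! ### Cohomology of simplicial sets -/

section CochainHomotopy

open Simplicial AlgebraicTopology

/-- The simplicial free abelian group on a simplicial set. -/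
noncomputable abbrev freeSimplicial : SSet.{u} ⥤ SimplicialObject AddCommGrpCat.{u} :=
  (SimplicialObject.whiskering _ _).obj AddCommGrpCat.free

/-- The complex of integral chains on a simplicial set. -/
noncomputable abbrev chains : SSet.{u} ⥤ ChainComplex AddCommGrpCat.{u} ℕ :=
  freeSimplicial ⋙ alternatingFaceMapComplex AddCommGrpCat

variable {K : Type v} [Field K] {S T U : SSet.{u}} {m : ℕ}

/-- A simplex as a chain. -/
noncomputable def simplexChain (σ : S _⦋m⦌) : (chains.obj S).X m :=
  FreeAbelianGroup.of σ

/-- The linear extension to chains of a function on simplices. -/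
noncomputable def evalChain (φ : S _⦋m⦌ → K) : (chains.obj S).X m →+ K :=
  FreeAbelianGroup.lift φ

lemma evalChain_simplexChain (φ : S _⦋m⦌ → K) (σ : S _⦋m⦌) :
    evalChain φ (simplexChain σ) = φ σ :=
  FreeAbelianGroup.lift_apply_of _ _

lemma chain_hom_ext {A : Type*} [AddCommGroup A] {a b : (chains.obj S).X m →+ A}
    (h : ∀ σ, a (simplexChain σ) = b (simplexChain σ)) : a = b :=
  FreeAbelianGroup.lift_ext a b h

lemma evalChain_zero : evalChain (0 : S _⦋m⦌ → K) = 0 :=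
  chain_hom_ext fun σ => by rw [evalChain_simplexChain]; rfl

lemma chains_map_simplexChain (f : S ⟶ T) (σ : S _⦋m⦌) :
    (chains.map f).f m (simplexChain σ) = simplexChain (f.app _ σ) :=
  FreeAbelianGroup.map_of_apply _

lemma freeSimplicial_δ_simplexChain (t : Fin (m + 2)) (σ : S _⦋m + 1⦌) :
    (freeSimplicial.obj S).δ t (simplexChain σ) = simplexChain (S.δ t σ) :=
  FreeAbelianGroup.map_of_apply _

lemma chains_d_simplexChain (σ : S _⦋m + 1⦌) :
    (chains.obj S).d (m + 1) m (simplexChain σ) =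
      ∑ t : Fin (m + 2), (-1 : ℤ) ^ (t : ℕ) • simplexChain (S.δ t σ) := by
  let evalAt : ((chains.obj S).X (m + 1) ⟶ (chains.obj S).X m) →+ (chains.obj S).X m :=
    AddMonoidHom.mk' (fun f => f (simplexChain σ)) fun _ _ => rfl
  refine (congrArg evalAt (alternatingFaceMapComplex_obj_d _ _)).trans ?_
  refine (map_sum evalAt _ _).trans (Finset.sum_congr rfl fun t _ => ?_)
  exact (map_zsmul evalAt _ _).trans (congrArg _ (freeSimplicial_δ_simplexChain t σ))

lemma evalChain_d {i j : ℤ} (h : i + 1 = j) (φ : Cochain K S i) (hm : (m : ℤ) = i)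
    (hm' : ((m + 1 : ℕ) : ℤ) = j) (x : (chains.obj S).X (m + 1)) :
    evalChain (φ ⟨m, hm⟩) ((chains.obj S).d (m + 1) m x) =
      evalChain (Cochain.d K h φ ⟨m + 1, hm'⟩) x := by
  suffices (evalChain (φ ⟨m, hm⟩)).comp ((chains.obj S).d (m + 1) m).hom =
      evalChain (Cochain.d K h φ ⟨m + 1, hm'⟩) from DFunLike.congr_fun this x
  refine chain_hom_ext fun σ => ?_
  rw [evalChain_simplexChain, Cochain.d_succ]
  refine (congrArg (evalChain (φ ⟨m, hm⟩)) (chains_d_simplexChain σ)).trans ?_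
  simp only [map_sum, map_zsmul, evalChain_simplexChain, zsmul_eq_mul]
  push_cast
  rfl

/-- The cochain `φ ∘ c`, for a family `c` of degree one maps on chains. -/
noncomputable def compDegreeOne (c : ∀ m, (chains.obj S).X m →+ (chains.obj T).X (m + 1))
    {k i : ℤ} (hk : k + 1 = i) (φ : Cochain K T i) : Cochain K S k :=
  fun m σ => evalChain (φ ⟨m.1 + 1, by have := m.2; omega⟩) (c m.1 (simplexChain σ))

lemma d_compDegreeOne_zero (c : ∀ m, (chains.obj S).X m →+ (chains.obj T).X (m + 1))
    {k i : ℤ} (hk : k + 1 = i) (φ : Cochain K T i) (h0 : ((0 : ℕ) : ℤ) = i) (σ : S _⦋0⦌) :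
    Cochain.d K hk (compDegreeOne c hk φ) ⟨0, h0⟩ σ = 0 :=
  rfl

lemma d_compDegreeOne_succ (c : ∀ m, (chains.obj S).X m →+ (chains.obj T).X (m + 1))
    {k i : ℤ} (hk : k + 1 = i) (φ : Cochain K T i) (hm : ((m + 1 : ℕ) : ℤ) = i)
    (σ : S _⦋m + 1⦌) :
    Cochain.d K hk (compDegreeOne c hk φ) ⟨m + 1, hm⟩ σ =
      evalChain (φ ⟨m + 1, hm⟩) (c m ((chains.obj S).d (m + 1) m (simplexChain σ))) := by
  rw [Cochain.d_succ]
  refine Eq.trans ?_ (congrArg (fun x => evalChain (φ ⟨m + 1, hm⟩) (c m x))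
    (chains_d_simplexChain σ)).symm
  simp only [map_sum, map_zsmul, zsmul_eq_mul]
  push_cast
  rfl

lemma d_compDegreeOne_eq_dNext (c : ∀ i j, (chains.obj S).X i ⟶ (chains.obj T).X j)
    {k i : ℤ} (hk : k + 1 = i) (φ : Cochain K T i) (hm : (m : ℤ) = i) (σ : S _⦋m⦌) :
    Cochain.d K hk (compDegreeOne (fun m => (c m (m + 1)).hom) hk φ) ⟨m, hm⟩ σ =
      evalChain (φ ⟨m, hm⟩) (dNext m c (simplexChain σ)) := by
  cases m with
  | zero =>
    rw [d_compDegreeOne_zero, dNext_eq_zero _ _ (by simp)]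
    exact (map_zero _).symm
  | succ m =>
    rw [d_compDegreeOne_succ, dNext_eq (i' := m) (w := by simp)]
    rfl

variable (K)

/-- Two simplicial maps induce the same map on cohomology. -/
def Cohomologous (f g : S ⟶ T) : Prop :=
  ∀ ⦃k i j : ℤ⦄ (hk : k + 1 = i) (hj : i + 1 = j) (φ : Cochain K T i), Cochain.d K hj φ = 0 →
    ∃ ψ : Cochain K S k, Cochain.d K hk ψ = Cochain.map K f i φ - Cochain.map K g i φ

/-- A simplicial map induces an injection (first clause) and a surjection (second clause) on
cohomology, both expressed through representing cocycles. -/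
def IsCohomologyIso (f : S ⟶ T) : Prop :=
  ∀ ⦃k i j : ℤ⦄ (hk : k + 1 = i) (hj : i + 1 = j),
    (∀ z : Cochain K T i, Cochain.d K hj z = 0 →
      (∃ y : Cochain K S k, Cochain.d K hk y = Cochain.map K f i z) →
        ∃ x : Cochain K T k, Cochain.d K hk x = z) ∧
    ∀ w : Cochain K S i, Cochain.d K hj w = 0 → ∃ z : Cochain K T i, Cochain.d K hj z = 0 ∧
      ∃ y : Cochain K S k, Cochain.d K hk y = w - Cochain.map K f i z

variable {K}

lemma Cohomologous.of_chainHomotopy {f g : S ⟶ T}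
    (c : _root_.Homotopy (chains.map f) (chains.map g)) : Cohomologous K f g := by
  intro k i j hk hj φ hφ
  refine ⟨compDegreeOne (fun m => (c.hom m (m + 1)).hom) hk φ, ?_⟩
  funext ⟨m, hm⟩ σ
  have prev_term : evalChain (φ ⟨m, hm⟩) (prevD m c.hom (simplexChain σ)) = 0 := by
    rw [prevD_eq (j' := m + 1) (w := by simp)]
    refine (evalChain_d hj φ hm (by omega) _).trans ?_
    rw [hφ]
    exact DFunLike.congr_fun evalChain_zero _
  have comm : (chains.map f).f m (simplexChain σ) = dNext m c.hom (simplexChain σ) +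
      prevD m c.hom (simplexChain σ) + (chains.map g).f m (simplexChain σ) :=
    congrArg (fun h => h (simplexChain σ)) (c.comm m)
  rw [chains_map_simplexChain, chains_map_simplexChain] at comm
  have eval_comm := congrArg (evalChain (φ ⟨m, hm⟩)) comm
  rw [map_add, map_add, prev_term, add_zero, evalChain_simplexChain,
    evalChain_simplexChain] at eval_comm
  rw [d_compDegreeOne_eq_dNext]
  exact eq_sub_of_add_eq eval_comm.symm

lemma Cohomologous.of_homotopy {f g : S ⟶ T} (H : SSet.Homotopy f g) : Cohomologous K f g :=
  .of_chainHomotopy (H.toSimplicialObjectHomotopy.whiskerRight AddCommGrpCat.free).toChainHomotopy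

lemma Cohomologous.refl (f : S ⟶ T) : Cohomologous K f f :=
  fun _ _ _ _ _ _ _ => ⟨0, by rw [map_zero, sub_self]⟩

lemma IsCohomologyIso.of_inverse {f : S ⟶ T} {g : T ⟶ S} (h₁ : Cohomologous K (𝟙 S) (f ≫ g))
    (h₂ : Cohomologous K (𝟙 T) (g ≫ f)) : IsCohomologyIso K f := by
  intro k i j hk hj
  constructor
  · rintro z hz ⟨y, hy⟩
    obtain ⟨x, hx⟩ := h₂ hk hj z hz
    refine ⟨x + Cochain.map K g k y, ?_⟩
    rw [map_add, hx, ← Cochain.map_d, hy]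
    exact sub_add_cancel _ _
  · intro w hw
    obtain ⟨y, hy⟩ := h₁ hk hj w hw
    exact ⟨Cochain.map K g i w, by rw [← Cochain.map_d, hw, map_zero], y, hy⟩

lemma IsCohomologyIso.comp {f : S ⟶ T} {g : T ⟶ U} (hf : IsCohomologyIso K f)
    (hg : IsCohomologyIso K g) : IsCohomologyIso K (f ≫ g) := by
  intro k i j hk hj
  constructor
  · intro z hz hy
    exact (hg hk hj).1 z hz ((hf hk hj).1 (Cochain.map K g i z)
      (by rw [← Cochain.map_d, hz, map_zero]) hy)
  · intro w hw
    obtain ⟨z, hz, y, hy⟩ := (hf hk hj).2 w hw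
    obtain ⟨z', hz', y', hy'⟩ := (hg hk hj).2 z hz
    refine ⟨z', hz', y + Cochain.map K f k y', ?_⟩
    rw [map_add, hy, ← Cochain.map_d, hy', map_sub]
    exact sub_add_sub_cancel _ _ _

end CochainHomotopy

section Retraction

open MonoidalCategory SSet Simplicial

variable {S T : SSet.{u}}

lemma mono_coprod_desc_ι₀_ι₁ :
    Mono (FunctorToTypes.coprod.desc ι₀ ι₁ : FunctorToTypes.coprod S S ⟶ S ⊗ Δ[1]) := by
  have ι₀_ne_ι₁ {n : ℕ} (x y : S _⦋n⦌) : ι₀.app _ x ≠ ι₁.app _ y := fun h =>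
    zero_ne_one (α := Fin 2) (DFunLike.congr_fun (congrArg Prod.snd h :
      ((ι₀.app _ x).2 : Δ[1] _⦋n⦌) = (ι₁.app _ y).2) 0)
  rw [NatTrans.mono_iff_mono_app]
  rintro ⟨⟨n⟩⟩
  rw [mono_iff_injective]
  rintro (x | x) (y | y) h
  · exact congrArg Sum.inl (congrArg Prod.fst h)
  · exact absurd h (ι₀_ne_ι₁ x y)
  · exact absurd h.symm (ι₀_ne_ι₁ y x)
  · exact congrArg Sum.inr (congrArg Prod.fst h)

/-- The section is a lift against `∅ ⟶ T` and the homotopy a lift against the inclusion of the two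
ends of the cylinder on `S`. -/
lemma exists_homotopy_of_rlp {p : S ⟶ T} (hp : SSet.modelCategoryQuillen.I.rlp p) :
    ∃ s : T ⟶ S, s ≫ p = 𝟙 T ∧ Nonempty (SSet.Homotopy (𝟙 S) (p ≫ s)) := by
  rw [← SSet.rlp_monomorphisms] at hp
  have := hp (Limits.initial.to T) (inferInstanceAs (Mono _))
  have sq : CommSq (Limits.initial.to S) (Limits.initial.to T) p (𝟙 T) :=
    ⟨Limits.initialIsInitial.hom_ext _ _⟩
  have := hp _ (mono_coprod_desc_ι₀_ι₁ (S := S))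
  have sq' : CommSq (FunctorToTypes.coprod.desc (𝟙 S) (p ≫ sq.lift))
      (FunctorToTypes.coprod.desc ι₀ ι₁) p (CartesianMonoidalCategory.fst _ _ ≫ p) := ⟨by
    ext n (x | x)
    · rfl
    · exact congrArg (fun f : S ⟶ T => f.app n x) (show p ≫ sq.lift ≫ p = p by simp)⟩
  exact ⟨sq.lift, sq.fac_right, ⟨{
    h := sq'.lift
    h₀ := congrArg (FunctorToTypes.coprod.inl ≫ ·) sq'.fac_left
    h₁ := congrArg (FunctorToTypes.coprod.inr ≫ ·) sq'.fac_left
    rel := by ext _ ⟨⟨_, ⟨⟩⟩, _⟩ }⟩⟩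

lemma IsCohomologyIso.of_rlp {K : Type v} [Field K] {p : S ⟶ T}
    (hp : SSet.modelCategoryQuillen.I.rlp p) : IsCohomologyIso K p := by
  obtain ⟨s, hs, ⟨H⟩⟩ := exists_homotopy_of_rlp hp
  exact .of_inverse (.of_homotopy H) (hs ▸ .refl _)

end Retraction

/-! ### Singular cochains and levels -/

section Singular

open unitInterval

variable {K : Type v} [Field K] {X Y Z : Type u} [TopologicalSpace X] [TopologicalSpace Y]
  [TopologicalSpace Z]

lemma IsCohomologyIso.of_homotopyEquiv (e : ContinuousMap.HomotopyEquiv Y Z) :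
    IsCohomologyIso K (TopCat.toSSet.map (TopCat.ofHom e.toFun)) := by
  obtain ⟨H⟩ := e.left_inv.symm
  obtain ⟨H'⟩ := e.right_inv.symm
  exact .of_inverse (g := TopCat.toSSet.map (TopCat.ofHom e.invFun))
    (.of_homotopy (TopCat.Homotopy.toSSet (f := 𝟙 (TopCat.of Y))
      (g := TopCat.ofHom e.toFun ≫ TopCat.ofHom e.invFun) H))
    (.of_homotopy (TopCat.Homotopy.toSSet (f := 𝟙 (TopCat.of Z))
      (g := TopCat.ofHom e.invFun ≫ TopCat.ofHom e.toFun) H'))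

lemma IsWeakHomotopyEquiv.isCohomologyIso {f : C(Y, Z)} (hf : IsWeakHomotopyEquiv f) :
    IsCohomologyIso K (TopCat.toSSet.map (TopCat.ofHom f)) :=
  (IsCohomologyIso.of_homotopyEquiv (MappingPath.homotopyEquiv f)).comp (.of_rlp hf.rlp_target)

/-- The inclusion `y ↦ (t, y)` of a slice of a product with a contractible space, as a homotopy
equivalence. -/
def sliceHomotopyEquiv (Y : Type*) [TopologicalSpace Y] {W : Type*} [TopologicalSpace W]
    [ContractibleSpace W] (t : W) : ContinuousMap.HomotopyEquiv Y (W × Y) where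
  toFun := .prodMk (.const Y t) (.id Y)
  invFun := .snd
  left_inv := .refl _
  right_inv := by
    obtain ⟨s, hs⟩ := id_nullhomotopic W
    have const_homotopic_id : (ContinuousMap.const W t).Homotopic (.id W) :=
      (ContinuousMap.homotopic_const_iff.2 (PathConnectedSpace.joined t s)).trans hs.symm
    exact const_homotopic_id.prodMap (.refl (.id Y))

/-- The morphism of DG modules over `C^*(X; K)` induced by a map of spaces over `X`. -/
noncomputable def restrictHom (γ : C(Z, Y)) {α : C(Y, X)} {β : C(Z, X)} (h : α.comp γ = β) :
    (singularCochainsMap K α).restrict ⟶ (singularCochainsMap K β).restrict where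
  f := Cochain.map K (TopCat.toSSet.map (TopCat.ofHom γ))
  map_d h m := Cochain.map_d K _ h m
  map_act {i j k} e m a := by
    subst h
    exact Cochain.map_mul K _ e m _

lemma quasiIso_restrictHom {γ : C(Z, Y)} {α : C(Y, X)} {β : C(Z, X)} (h : α.comp γ = β)
    (hγ : IsCohomologyIso K (TopCat.toSSet.map (TopCat.ofHom γ))) :
    DGModule.quasiIso _ (restrictHom (K := K) γ h) :=
  (DGModule.quasiIso_iff _).2 fun hk hj => hγ hk hj

lemma nonempty_iso_of_quasiIso {A : DGAlgebra.{v, w} K} {M N : DGModule A} (f : M ⟶ N)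
    (hf : DGModule.quasiIso A f) :
    Nonempty ((DerivedCategory.Q A).obj M ≅ (DerivedCategory.Q A).obj N) := by
  have : IsIso ((DerivedCategory.Q A).map f) :=
    (DGModule.homotopyQuasiIso A).Q_inverts _ ((DGModule.homotopyQuasiIso_iff f).2 hf)
  exact ⟨asIso ((DerivedCategory.Q A).map f)⟩

section Level

variable {T : Type*} [Category T] [HasShift T ℤ] (Δ : Set (Pretriangulated.Triangle T)) (C : T)
  {M N : T}

lemma thick_of_iso (e : M ≅ N) : ∀ n, thick Δ C n M → thick Δ C n N
  | 0, h => Limits.IsZero.of_iso h e.symm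
  | 1, h => fun P h₁ h₂ h₃ h₄ h₅ => P.prop_of_iso e (h P h₁ h₂ h₃ h₄ h₅)
  | _ + 2, h => fun P h₁ h₂ h₃ => P.prop_of_iso e (h P h₁ h₂ h₃)

lemma level_eq_of_iso (e : M ≅ N) : level Δ C M = level Δ C N :=
  iInf_congr fun n =>
    iInf_congr_Prop ⟨thick_of_iso Δ C e n, thick_of_iso Δ C e.symm n⟩ fun _ => rfl

end Level

variable (K)

lemma levelOver_eq_of_isCohomologyIso {γ : C(Z, Y)} {α : C(Y, X)} {β : C(Z, X)}
    (h : α.comp γ = β) (hγ : IsCohomologyIso K (TopCat.toSSet.map (TopCat.ofHom γ))) :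
    levelOver K α = levelOver K β :=
  level_eq_of_iso _ _ (nonempty_iso_of_quasiIso _ (quasiIso_restrictHom h hγ)).some

lemma levelOver_eq_of_homotopic {α β : C(Y, X)} (h : α.Homotopic β) :
    levelOver K α = levelOver K β := by
  obtain ⟨H⟩ := h
  have : ContractibleSpace I := (convex_Icc 0 1).contractibleSpace ⟨0, by simp⟩
  have levelOver_slice (t : I) (γ : C(Y, X)) (hγ : ∀ y, H (t, y) = γ y) :
      levelOver K H.toContinuousMap = levelOver K γ :=
    levelOver_eq_of_isCohomologyIso K (γ := (sliceHomotopyEquiv Y t).toFun)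
      (ContinuousMap.ext hγ) (.of_homotopyEquiv (sliceHomotopyEquiv Y t))
  rw [← levelOver_slice 0 α H.map_zero_left, ← levelOver_slice 1 β H.map_one_left]

end Singular

end DGLevel

theorem proposition2p2 {K : Type v} [Field K] {X Y Z : Type u}
    [TopologicalSpace X] [TopologicalSpace Y] [TopologicalSpace Z]
    (α : C(Y, X)) (β : C(Z, X)) (f : C(Y, Z))
    (hf : DGLevel.IsWeakHomotopyEquiv f) (h : α.Homotopic (β.comp f)) :
    DGLevel.levelOver K β = DGLevel.levelOver K α :=
  calc
    DGLevel.levelOver K β = DGLevel.levelOver K (β.comp f) :=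
      DGLevel.levelOver_eq_of_isCohomologyIso K rfl hf.isCohomologyIso
    _ = DGLevel.levelOver K α := (DGLevel.levelOver_eq_of_homotopic K h).symm
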